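/- **Setting.** Let $p\ge 1$ and $s$ be integers, $\Theta\subseteq\mathbb R^p$ open, and let $\mathcal P=(P_\theta)_{\theta\in\Theta}$ be a statistical model on a measurable space $\mathcal X$, dominated by a $\sigma$-finite measure $\mu$, with densities $f_\theta=dP_\theta/d\mu$ such that $(\theta,x)\mapsto f_\theta(x)$ is measurable. Put $\xi_\theta=\sqrt{f_\theta}$, and let $e_1,\dots,e_p$ be the canonical basis of $\mathbb R^p$. The model is *$L^2(\mu)$-differentiable along canonical directions at $\theta$* if there are $\dot\xi_{\theta,1},\dots,\dot\xi_{\theta,p}\in L^2(\mu)$ with $\|\xi_{\theta+te_i}-\xi_\theta-t\,\dot\xi_{\theta,i}\|_{L^2(\mu)}=o(|t|)$ as $t\to0$, for every $i$; its Fisher information is then the $p\times p$ matrix $I_P(\theta)=4\int\dot\xi_\theta\dot\xi_\theta^{T}\,d\mu$. A function $\varphi$ on an open set $D\subseteq\mathbb R^d$ is *nice* if for every $i$, for Lebesgue-almost every choice of the coordinates other than the $i$-th, it is absolutely continuous as a function of the $i$-th coordinate on every compact interval of the corresponding section of $D$; a vector-valued function is nice if its components are. A nice function has partial derivatives almost everywhere.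 For $\psi:\Theta\to\mathbb R^s$, $\nabla\psi(\theta)$ is the $p\times s$ matrix with entries $\partial_i\psi_j(\theta)$. A *regular prior* is a probability measure $H$ on $\mathbb R^p$, supported in the closed unit ball, with a continuous Lebesgue density $q\geq 0$ that is nice on $\mathbb R^p$ and such that $\|\nabla q\|^2\mathbf 1_{\{q>0\}}/q$ is Lebesgue-integrable; put $I_H=\int\nabla q\,\nabla q^{T}\,\mathbf 1_{\{q>0\}}/q\,du$. For $c>0$ and $n\geq 1$ let $$G_{c,n}=\int\nabla\psi\bigl(\theta_0+ch/\sqrt n\bigr)\,dH(h),\qquad I_{c,n}=\tfrac1{c^2}I_H+\int I_P\bigl(\theta_0+ch/\sqrt n\bigr)\,dH(h),\qquad \Gamma_{c,n}=G_{c,n}^{T}\,I_{c,n}^{-1}\,G_{c,n}.$$ **Assumptions.** Let $N\subseteq\Theta$ be an open neighbourhood of $\theta_0$ such that $\mathcal P$ is $L^2(\mu)$-differentiable along canonical directions at all $\theta\in N$, and $\psi$ is nice and bounded on $N$, with $\nabla\psi$ (defined almost everywhere) bounded on $N$. Assume that the partial derivatives of $\psi$ exist at $\theta_0$. **Theorem.**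 (1) Assume that $I_P(\theta_0)$ is nonsingular and that for some regular prior $H$, for all large $c$ and then all large $n$ (depending on $c$), $h\mapsto\mathrm{Tr}\,I_P(\theta_0+ch/\sqrt n)$ is $H$-integrable, and $$\lim_{c\to\infty}\ \lim_{n\to\infty}\ \Gamma_{c,n}=\nabla\psi(\theta_0)^{T}I_P(\theta_0)^{-1}\nabla\psi(\theta_0)$$ componentwise (the inner limit existing for all large $c$). Then, for every quadratic form $\ell:\mathbb R^s\to[0,\infty)$ and every sequence of (measurable) statistics $S_n:\mathcal X^n\to\mathbb R^s$, $$\liminf_{c\to\infty}\ \liminf_{n\to\infty}\ \sup_{\theta\in\Theta:\ \sqrt n\,\|\theta-\theta_0\|\le c}E_\theta^{\otimes n}\Bigl[\ell\bigl(\sqrt n\,(S_n-\psi(\theta))\bigr)\Bigr]\ \ge\ \int_{\mathbb R^s}\ell(v)\,d\mathcal N\bigl(0,\nabla\psi(\theta_0)^{T}I_P(\theta_0)^{-1}\nabla\psi(\theta_0)\bigr)(v),$$ where $E_\theta^{\otimes n}$ is the expectation under $P_\theta^{\otimes n}$ and both sides take values in $[0,\infty]$. (2) Regular priors exist, and the assumption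 of (1) holds for every regular prior as soon as $\nabla\psi$ (on the set of points of $N$ where all partial derivatives exist) and $I_P$ are continuous at $\theta_0$, with $I_P(\theta_0)$ nonsingular. -/

import Mathlib

open MeasureTheory ProbabilityTheory Filter Topology Asymptotics
open scoped NNReal ENNReal Matrix

noncomputable section

namespace LAM

/-- The Euclidean space `ℝ^d`. -/
abbrev E (d : ℕ) : Type := EuclideanSpace ℝ (Fin d)

/-- The `i`-th canonical basis vector of `ℝ^d`. -/
def e {d : ℕ} (i : Fin d) : E d := EuclideanSpace.single i 1

/-- The point `(t, v)` of `ℝ^d` with `i`-th coordinate `t` and with other coordinates `v`. -/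
def glue {d : ℕ} (i : Fin d) (t : ℝ) (v : {j : Fin d // j ≠ i} → ℝ) : E d :=
  WithLp.toLp 2 (fun j => if h : j = i then t else v ⟨j, h⟩)

/-- `φ` is nice on the open set `D`: for every `i`, for Lebesgue-almost all `u_{-i} = v`, the
function `t ↦ φ (t, v)` is absolutely continuous on every compact interval contained in the
section `{t | (t, v) ∈ D}`. (If `v` is not in the projection of `D`, then the section is empty and
the condition is void.) -/
def IsNice {d : ℕ} (D : Set (E d)) (φ : E d → ℝ) : Prop :=
  ∀ i : Fin d, ∀ᵐ v : {j : Fin d // j ≠ i} → ℝ,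
    ∀ a b : ℝ, a ≤ b → (∀ t ∈ Set.Icc a b, glue i t v ∈ D) →
      AbsolutelyContinuousOnInterval (fun t => φ (glue i t v)) a b

/-- The `p × s` matrix `∇ψ(θ)`, whose `(i, j)` entry is the partial derivative `∂_i ψ_j (θ)`
(to be used only where these partial derivatives exist, or almost everywhere). -/
def grad {p s : ℕ} (ψ : E p → E s) (θ : E p) : Matrix (Fin p) (Fin s) ℝ :=
  Matrix.of fun i j => lineDeriv ℝ (fun θ' => ψ θ' j) θ (e i)

/-- All partial derivatives `∂_i ψ_j (θ)` exist. -/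
def HasPartials {p s : ℕ} (ψ : E p → E s) (θ : E p) : Prop :=
  ∀ (i : Fin p) (j : Fin s), LineDifferentiableAt ℝ (fun θ' => ψ θ' j) θ (e i)

/-- A statistical model `(P_θ)_{θ ∈ Θ}` on `X`, dominated by `μ`, given by its densities `f_θ` with
respect to `μ`, with `(θ, x) ↦ f_θ(x)` measurable on `Θ × X`. Values of the density for
`θ ∉ Θ` are irrelevant. -/
structure DominatedModel {p : ℕ} (Θ : Set (E p)) {X : Type*} [MeasurableSpace X]
    (μ : Measure X) where
  density : E p → X → ℝ≥0
  measurable_density : Measurable fun z : Θ × X => density z.1 z.2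
  lintegral_density : ∀ θ ∈ Θ, ∫⁻ x, (density θ x : ℝ≥0∞) ∂μ = 1

namespace DominatedModel

variable {p : ℕ} {Θ : Set (E p)} {X : Type*} [MeasurableSpace X] {μ : Measure X}

/-- The distribution `P_θ = f_θ · μ`. -/
def law (M : DominatedModel Θ μ) (θ : E p) : Measure X :=
  μ.withDensity fun x => (M.density θ x : ℝ≥0∞)

/-- The distribution `P_θ^{⊗n}` of an `n`-sample. -/
def sampleLaw (M : DominatedModel Θ μ) (n : ℕ) (θ : E p) : Measure (Fin n → X) :=
  Measure.pi fun _ => M.law θ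

/-- The square root `ξ_θ` of the density. -/
def root (M : DominatedModel Θ μ) (θ : E p) (x : X) : ℝ :=
  Real.sqrt (M.density θ x)

/-- The functions `g 1, …, g p ∈ L²(μ)` are `L²(μ)`-partial derivatives of the model at `θ`: for
each `i`, `‖ξ_{θ + t e_i} - ξ_θ - t g_i‖_{L²(μ)} = o(|t|)` as `t → 0`. -/
def HasL2Partials (M : DominatedModel Θ μ) (θ : E p) (g : Fin p → X → ℝ) : Prop :=
  ∀ i : Fin p, MemLp (g i) 2 μ ∧
    (fun t : ℝ =>
      (eLpNorm (fun x => M.root (θ + t • e i) x - M.root θ x - t * g i x) 2 μ).toReal)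
      =o[𝓝 0] fun t : ℝ => t

/-- The maximal risk, for the loss `ℓ`, of the statistic `S` of an `n`-sample, as an estimator of
`ψ(θ)`, over the parameters `θ ∈ Θ` with `√n ‖θ - θ₀‖ ≤ c`; a number in `[0, ∞]`. -/
def maxRisk {s : ℕ} (M : DominatedModel Θ μ) (ψ : E p → E s) (ℓ : QuadraticForm ℝ (E s))
    (θ₀ : E p) (c : ℝ) (n : ℕ) (S : (Fin n → X) → E s) : ℝ≥0∞ :=
  ⨆ θ ∈ {θ : E p | θ ∈ Θ ∧ √(n : ℝ) * ‖θ - θ₀‖ ≤ c},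
    ∫⁻ x, ENNReal.ofReal (ℓ (√(n : ℝ) • (S x - ψ θ))) ∂(M.sampleLaw n θ)

end DominatedModel

/-- The Fisher information matrix `4 ∫ g ⊗ g dμ`, when `g` is the vector of the
`L²(μ)`-partial derivatives of the model. -/
def fisherInfo {p : ℕ} {X : Type*} [MeasurableSpace X] (μ : Measure X) (g : Fin p → X → ℝ) :
    Matrix (Fin p) (Fin p) ℝ :=
  Matrix.of fun i j => 4 * ∫ x, g i x * g j x ∂μ

/-- `q` is the density of a sufficiently regular prior `H` on `ℝ^p`: a continuous probability
density which vanishes outside the closed unit ball, is nice on `ℝ^p`, and is such that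
`‖∇q‖² 1_{q > 0} / q` is Lebesgue-integrable. -/
structure IsRegularPrior {p : ℕ} (q : E p → ℝ) : Prop where
  continuous : Continuous q
  nonneg : ∀ u, 0 ≤ q u
  lintegral_eq_one : ∫⁻ u, ENNReal.ofReal (q u) = 1
  eq_zero : ∀ u, 1 < ‖u‖ → q u = 0
  nice : IsNice Set.univ q
  integrable : Integrable fun u =>
    {u | 0 < q u}.indicator (fun u => (∑ i, lineDeriv ℝ q u (e i) ^ 2) / q u) u

/-- The prior `H` with density `q`. -/
def priorMeasure {p : ℕ} (q : E p → ℝ) : Measure (E p) :=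
  volume.withDensity fun u => ENNReal.ofReal (q u)

/-- The Fisher information matrix `∫ ∇q ⊗ ∇q 1_{q > 0} / q` of the prior with density `q`. -/
def priorInfo {p : ℕ} (q : E p → ℝ) : Matrix (Fin p) (Fin p) ℝ :=
  Matrix.of fun i j => ∫ u, {u | 0 < q u}.indicator
    (fun u => lineDeriv ℝ q u (e i) * lineDeriv ℝ q u (e j) / q u) u

/-- `G(θ₀, c, n) = ∫ ∇ψ(θ₀ + c h / √n) dH(h)`. -/
def avgGrad {p s : ℕ} (ψ : E p → E s) (q : E p → ℝ) (θ₀ : E p) (c : ℝ) (n : ℕ) :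
    Matrix (Fin p) (Fin s) ℝ :=
  Matrix.of fun i j => ∫ h, grad ψ (θ₀ + (c / √(n : ℝ)) • h) i j ∂(priorMeasure q)

/-- `I(θ₀, c, n) = c⁻² I_H + ∫ I_P(θ₀ + c h / √n) dH(h)`. -/
def avgInfo {p : ℕ} (I : E p → Matrix (Fin p) (Fin p) ℝ) (q : E p → ℝ) (θ₀ : E p) (c : ℝ)
    (n : ℕ) : Matrix (Fin p) (Fin p) ℝ :=
  (1 / c ^ 2) • priorInfo q +
    Matrix.of fun i j => ∫ h, I (θ₀ + (c / √(n : ℝ)) • h) i j ∂(priorMeasure q)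

/-- `Γ(θ₀, c, n) = G(θ₀, c, n)ᵀ I(θ₀, c, n)⁻¹ G(θ₀, c, n)`. -/
def Gam {p s : ℕ} (I : E p → Matrix (Fin p) (Fin p) ℝ) (ψ : E p → E s) (q : E p → ℝ)
    (θ₀ : E p) (c : ℝ) (n : ℕ) : Matrix (Fin s) (Fin s) ℝ :=
  (avgGrad ψ q θ₀ c n)ᵀ * (avgInfo I q θ₀ c n)⁻¹ * avgGrad ψ q θ₀ c n

/-- The limiting covariance matrix `∇ψ(θ₀)ᵀ I_P(θ₀)⁻¹ ∇ψ(θ₀)`. -/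
def limitCov {p s : ℕ} (I : E p → Matrix (Fin p) (Fin p) ℝ) (ψ : E p → E s) (θ₀ : E p) :
    Matrix (Fin s) (Fin s) ℝ :=
  (grad ψ θ₀)ᵀ * (I θ₀)⁻¹ * grad ψ θ₀

/-- The convergence `lim_{c → ∞} lim_{n → ∞} Γ(θ₀, c, n) = ∇ψ(θ₀)ᵀ I_P(θ₀)⁻¹ ∇ψ(θ₀)`, all of whose
ingredients are required to be well defined: `I_P(θ₀)` is nonsingular, and the trace of `I_P` is
integrable with respect to the rescaled priors for `c` large and then `n` large. -/
structure GamConverges {p s : ℕ} (I : E p → Matrix (Fin p) (Fin p) ℝ) (ψ : E p → E s)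
    (q : E p → ℝ) (θ₀ : E p) : Prop where
  nonsingular : IsUnit (I θ₀).det
  integrable : ∀ᶠ c : ℝ in atTop, ∀ᶠ n : ℕ in atTop,
    Integrable (fun h => (I (θ₀ + (c / √(n : ℝ)) • h)).trace) (priorMeasure q)
  tendsto : ∃ L : ℝ → Matrix (Fin s) (Fin s) ℝ,
    (∀ᶠ c : ℝ in atTop, Tendsto (fun n : ℕ => Gam I ψ q θ₀ c n) atTop (𝓝 (L c))) ∧
      Tendsto L atTop (𝓝 (limitCov I ψ θ₀))

end LAM

end

namespace LAM

/-! ### Absolutely continuous functions on intervals -/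

/-! A maximal risk dominates a Bayes risk, and the van Trees inequality bounds the Bayes risk from
below. The prior is `H` carried to the ball of radius `c / √n` around `θ₀` by `h ↦ θ₀ + (c / √n) h`.

Reduction to a scalar problem: a nonnegative quadratic form is a sum of squares of linear forms
`b_k` (`exists_sum_sq_of_nonneg`), so its risk is a sum of scalar quadratic risks for the targets `φ
= b_k · ψ`. Since `ψ` is bounded on `N`, clipping `b_k · S_n` to the range of the target only lowers
the risk, so the statistic `T` may be taken bounded.

Cramér–Rao with bias (`HasL2Partials.cramerRao`): the mean of `T` is `m(θ) = ⟨T Ξ, Ξ⟩`, where `Ξ` is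
the tensor power of the root density. Tensor powers are multilinear, so `Ξ`, and then `m`, inherit
partial derivatives from the `L²` derivatives of the model. Cauchy–Schwarz bounds `(w · ∇m + β (m -
φ))²` by the risk times `wᵀ (n I_P) w + β²`, for every vector `w` and every real `β`.

Van Trees (`IsRegularPrior.vanTrees`): choose for `β` the prior score `w · ∇q / q`, multiply by `q`
and integrate. Since `q` vanishes on the unit sphere, integration by parts
(`IsRegularPrior.integral_parts`) turns `∫ (∂_i m q + (m - φ) ∂_i q)` into `∫ ∂_i φ q`: the unknown
mean disappears. A second Cauchy–Schwarz bounds `(w · ∫ ∇φ dH)²` by the Bayes risk times `wᵀ (I_H +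
c² ∫ I_P dH) w`. The best `w` gives `aᵀ Γ a ≤ n · (Bayes risk)`, with `a = b_k`. Summing over `k`
and letting first `n`, then `c`, tend to infinity gives `∑ b_kᵀ Σ b_k`, with `Σ` the limiting
covariance; this is the Gaussian integral of the loss.

The delicate point is the integration by parts for `m`: its partial derivatives exist everywhere on
`N`, but only their products with `q` are known to be integrable. Absolute continuity of `m q` on
chords of the ball is obtained nevertheless, because `q` is absolutely continuous and `m` is bounded
(`absolutelyContinuousOnInterval_mul_of_hasDerivAt`).

For part (2), under continuity at `θ₀` the averages converge to the values at `θ₀` as `n → ∞`; the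
remaining term `I_H / c²` vanishes as `c → ∞`. Normalised squares of smooth bumps are regular
priors. -/

theorem absolutelyContinuousOnInterval_of_dist_le {f g : ℝ → ℝ} {a b : ℝ}
    (hg : AbsolutelyContinuousOnInterval g a b)
    (h : ∀ x ∈ Set.uIcc a b, ∀ y ∈ Set.uIcc a b, dist (f x) (f y) ≤ dist (g x) (g y)) :
    AbsolutelyContinuousOnInterval f a b := by
  rw [absolutelyContinuousOnInterval_iff] at hg ⊢
  intro ε hε
  obtain ⟨δ, hδ, hd⟩ := hg ε hε
  refine ⟨δ, hδ, fun E hE hlt => lt_of_le_of_lt ?_ (hd E hE hlt)⟩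
  exact Finset.sum_le_sum fun i hi => h _ (hE.1 i hi).1 _ (hE.1 i hi).2

/-- Differentiability at every point, with an integrable derivative, makes `u` a primitive of `u'`
up to a constant; no continuity of `u'` is needed. -/
theorem absolutelyContinuousOnInterval_of_hasDerivAt {u u' : ℝ → ℝ} {a b : ℝ} (hab : a ≤ b)
    (hu : ∀ t ∈ Set.Icc a b, HasDerivAt u (u' t) t) (hi : IntervalIntegrable u' volume a b) :
    AbsolutelyContinuousOnInterval u a b := by
  refine absolutelyContinuousOnInterval_of_dist_le
    (hi.absolutelyContinuousOnInterval_intervalIntegral (c := a) Set.left_mem_uIcc) ?_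
  have key : ∀ x ∈ Set.uIcc a b, ∫ v in a..x, u' v = u x - u a := by
    intro x hx
    rw [Set.uIcc_of_le hab] at hx
    refine intervalIntegral.integral_eq_sub_of_hasDerivAt ?_ (hi.mono_set ?_)
    · intro t ht
      rw [Set.uIcc_of_le hx.1] at ht
      exact hu t ⟨ht.1, ht.2.trans hx.2⟩
    · rw [Set.uIcc_of_le hx.1, Set.uIcc_of_le hab]
      exact Set.Icc_subset_Icc_right hx.2
  intro x hx y hy
  simp only [key x hx, key y hy, dist_sub_right, le_refl]

/-- The product of a bounded differentiable function `u` with a nonnegative absolutely continuous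
function `q` is absolutely continuous, provided that `u' q` is integrable (`u'` need not be). -/
theorem absolutelyContinuousOnInterval_mul_of_hasDerivAt {u u' q : ℝ → ℝ} {a b C : ℝ}
    (hab : a ≤ b) (hu : ∀ t ∈ Set.Icc a b, HasDerivAt u (u' t) t)
    (huC : ∀ t ∈ Set.Icc a b, |u t| ≤ C)
    (hq : AbsolutelyContinuousOnInterval q a b) (hq0 : ∀ t, 0 ≤ q t)
    (hi : IntervalIntegrable (fun t => u' t * q t) volume a b) :
    AbsolutelyContinuousOnInterval (fun t => u t * q t) a b := by
  have hC : 0 ≤ C := (abs_nonneg _).trans (huC a ⟨le_rfl, hab⟩)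
  -- An integrable function whose primitive controls every increment of `u q`.
  set k : ℝ → ℝ := fun t => |u' t * q t| + C * |deriv q t| with hk
  have hki : IntervalIntegrable k volume a b := hi.abs.add (hq.intervalIntegrable_deriv.abs.const_mul C)
  have hk0 : ∀ t, 0 ≤ k t := fun t => by positivity
  have key : ∀ x y, a ≤ x → x ≤ y → y ≤ b → |u y * q y - u x * q x| ≤ ∫ t in x..y, k t := by
    intro x y hax hxy hyb
    have hsub : Set.uIcc x y ⊆ Set.uIcc a b := by
      rw [Set.uIcc_of_le hxy, Set.uIcc_of_le hab]
      exact Set.Icc_subset_Icc hax hyb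
    have hqxy := hq.mono hsub
    have hkxy := hki.mono_set hsub
    have hixy := hi.mono_set hsub
    have huxy : ∀ t ∈ Set.Icc x y, HasDerivAt u (u' t) t := fun t ht =>
      hu t ⟨hax.trans ht.1, ht.2.trans hyb⟩
    -- If `q` vanishes at some `z` of the interval, the endpoint values of `u q` are at most `C |q x
    -- - q z|` and `C |q y - q z|`, and `u'` plays no role. Otherwise `q` is bounded away from `0`
    -- there, so `u' = (u' q) / q` is integrable and the product rule applies.
    by_cases hz : ∃ z ∈ Set.Icc x y, q z = 0
    · obtain ⟨z, hz, hz0⟩ := hz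
      have hsub1 : Set.uIcc x z ⊆ Set.uIcc x y := by
        rw [Set.uIcc_of_le hz.1, Set.uIcc_of_le hxy]; exact Set.Icc_subset_Icc_right hz.2
      have hsub2 : Set.uIcc z y ⊆ Set.uIcc x y := by
        rw [Set.uIcc_of_le hz.2, Set.uIcc_of_le hxy]; exact Set.Icc_subset_Icc_left hz.1
      have hd : ∀ c d, c ≤ d → Set.uIcc c d ⊆ Set.uIcc x y →
          C * |q d - q c| ≤ ∫ t in c..d, k t := by
        intro c d hcd hs
        rw [← (hqxy.mono hs).integral_deriv_eq_sub]
        calc C * |∫ t in c..d, deriv q t| ≤ C * ∫ t in c..d, |deriv q t| := by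
              gcongr
              exact intervalIntegral.abs_integral_le_integral_abs hcd
          _ = ∫ t in c..d, C * |deriv q t| := by rw [intervalIntegral.integral_const_mul]
          _ ≤ ∫ t in c..d, k t := by
              refine intervalIntegral.integral_mono hcd
                ((hqxy.mono hs).intervalIntegrable_deriv.abs.const_mul C) (hkxy.mono_set hs) ?_
              intro t
              simp only [hk]
              linarith [abs_nonneg (u' t * q t)]
      have h1 := hd x z hz.1 hsub1
      have h2 := hd z y hz.2 hsub2
      rw [hz0, zero_sub, abs_neg, abs_of_nonneg (hq0 x)] at h1
      rw [hz0, sub_zero, abs_of_nonneg (hq0 y)] at h2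
      rw [← intervalIntegral.integral_add_adjacent_intervals (hkxy.mono_set hsub1)
        (hkxy.mono_set hsub2)]
      refine (abs_sub _ _).trans ?_
      rw [abs_mul, abs_mul, abs_of_nonneg (hq0 x), abs_of_nonneg (hq0 y)]
      have h3 := mul_le_mul_of_nonneg_right (huC x ⟨hax, hxy.trans hyb⟩) (hq0 x)
      have h4 := mul_le_mul_of_nonneg_right (huC y ⟨hax.trans hxy, hyb⟩) (hq0 y)
      linarith
    · push Not at hz
      have hu'i : IntervalIntegrable u' volume x y := by
        have := hixy.mul_continuousOn (g := fun t => (q t)⁻¹) (hqxy.continuousOn.inv₀ (by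
          rw [Set.uIcc_of_le hxy]; exact hz))
        refine this.congr ?_
        intro t ht
        rw [Set.uIoc_of_le hxy] at ht
        have := hz t ⟨ht.1.le, ht.2⟩
        simp only
        field_simp
      have huac := absolutelyContinuousOnInterval_of_hasDerivAt hxy huxy hu'i
      have hw := huac.integral_deriv_mul_eq_sub hqxy
      rw [← hw]
      refine (intervalIntegral.abs_integral_le_integral_abs hxy).trans ?_
      refine intervalIntegral.integral_mono_on hxy ?_ hkxy ?_
      · exact ((huac.intervalIntegrable_deriv.mul_continuousOn hqxy.continuousOn).add
          (hqxy.intervalIntegrable_deriv.continuousOn_mul huac.continuousOn)).abs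
      · intro t ht
        rw [(huxy t ht).deriv]
        refine (abs_add_le _ _).trans ?_
        simp only [hk]
        gcongr
        rw [abs_mul]
        gcongr
        exact huC t ⟨hax.trans ht.1, ht.2.trans hyb⟩
  refine absolutelyContinuousOnInterval_of_dist_le
    (hki.absolutelyContinuousOnInterval_intervalIntegral (c := a) Set.left_mem_uIcc) ?_
  have key2 : ∀ x y, a ≤ x → x ≤ y → y ≤ b → dist (u x * q x) (u y * q y) ≤
      dist (∫ t in a..x, k t) (∫ t in a..y, k t) := by
    intro x y hax hxy hyb
    rw [dist_comm, dist_comm (∫ t in a..x, k t), Real.dist_eq, Real.dist_eq]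
    have hs : ∀ c d, a ≤ c → c ≤ d → d ≤ b → IntervalIntegrable k volume c d := by
      intro c d h1 h2 h3
      refine hki.mono_set ?_
      rw [Set.uIcc_of_le h2, Set.uIcc_of_le hab]
      exact Set.Icc_subset_Icc h1 h3
    rw [intervalIntegral.integral_interval_sub_left (hs a y le_rfl (hax.trans hxy) hyb)
      (hs a x le_rfl hax (hxy.trans hyb))]
    exact (key x y hax hxy hyb).trans (le_abs_self _)
  intro x hx y hy
  rw [Set.uIcc_of_le hab] at hx hy
  rcases le_total x y with h | h
  · exact key2 x y hx.1 h hy.2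
  · rw [dist_comm, dist_comm (∫ t in a..x, k t)]
    exact key2 y x hy.1 h hx.2

/-! ### Lines parallel to the axes -/

theorem glue_same {d : ℕ} (i : Fin d) (t : ℝ) (v : {j : Fin d // j ≠ i} → ℝ) :
    glue i t v i = t := by
  simp [glue]

theorem glue_add {d : ℕ} (i : Fin d) (t s : ℝ) (v : {j : Fin d // j ≠ i} → ℝ) :
    glue i (t + s) v = glue i t v + s • e i := by
  ext j
  by_cases h : j = i
  · subst h; simp [glue, e]
  · simp [glue, e, h]

theorem exists_eq_glue {d : ℕ} (i : Fin d) (x : E d) :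
    glue i (x i) (fun j => x j) = x := by
  ext j
  by_cases h : j = i
  · subst h; simp [glue]
  · simp [glue, h]

theorem continuous_glue {d : ℕ} (i : Fin d) :
    Continuous fun z : ℝ × ({j : Fin d // j ≠ i} → ℝ) => glue i z.1 z.2 := by
  refine (PiLp.continuous_toLp 2 _).comp (continuous_pi fun j => ?_)
  by_cases h : j = i
  · simp only [h, dite_true]; fun_prop
  · simp only [h, dite_false]; fun_prop

theorem norm_glue_sq {d : ℕ} (i : Fin d) (t : ℝ) (v : {j : Fin d // j ≠ i} → ℝ) :
    ‖glue i t v‖ ^ 2 = t ^ 2 + ∑ j, v j ^ 2 := by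
  rw [EuclideanSpace.real_norm_sq_eq, ← Finset.add_sum_erase _ _ (Finset.mem_univ i), glue_same,
    Finset.sum_subtype (Finset.univ.erase i) (p := fun j => j ≠ i) (by simp)]
  congr 1
  exact Finset.sum_congr rfl fun j _ => by simp [glue, j.2]

/-- The measurable equivalence that inserts the `i`-th coordinate. -/
def glueEquiv {d : ℕ} (i : Fin d) : ℝ × ({j : Fin d // j ≠ i} → ℝ) ≃ᵐ E d where
  toFun z := glue i z.1 z.2
  invFun x := (x i, fun j => x j)
  left_inv z := by
    ext j
    · exact glue_same i z.1 z.2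
    · simp [glue, j.2]
  right_inv x := exists_eq_glue i x
  measurable_toFun := (continuous_glue i).measurable
  measurable_invFun := by
    refine Measurable.prodMk ?_ (measurable_pi_lambda _ fun j => ?_)
    · exact (EuclideanSpace.proj (𝕜 := ℝ) i).continuous.measurable
    · exact (EuclideanSpace.proj (𝕜 := ℝ) (j : Fin d)).continuous.measurable

theorem measurePreserving_glue {d : ℕ} (i : Fin d) :
    MeasurePreserving (glueEquiv i) (volume.prod volume) volume := by
  have h1 := (measurePreserving_piEquivPiSubtypeProd (fun _ : Fin d => (volume : Measure ℝ))
    (fun j => j = i)).symm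
  have h2 : MeasurePreserving (MeasurableEquiv.funUnique {j : Fin d // j = i} ℝ)
      (@Measure.pi {j : Fin d // j = i} (fun _ => ℝ) (Subtype.fintype fun j => j = i) _
        fun _ => volume) volume := by
    convert! measurePreserving_funUnique (volume : Measure ℝ) {j : Fin d // j = i}
  have h3 := h2.symm.prod (MeasurePreserving.id
    (volume : Measure ({j : Fin d // j ≠ i} → ℝ)))
  have h4 := (PiLp.volume_preserving_toLp (Fin d)).comp (h1.comp h3)
  convert! h4 using 1

theorem hasLineDerivAt_glue_iff {d : ℕ} {f : E d → ℝ} {i : Fin d} {t l : ℝ}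
    {v : {j : Fin d // j ≠ i} → ℝ} :
    HasLineDerivAt ℝ f l (glue i t v) (e i) ↔ HasDerivAt (fun s => f (glue i s v)) l t := by
  have : (fun s : ℝ => f (glue i t v + s • e i)) = fun s => f (glue i (t + s) v) := by
    funext s; rw [glue_add]
  rw [HasLineDerivAt, this]
  constructor
  · intro h
    have h1 : HasDerivAt (fun s => f (glue i (t + s) v)) l (-t + t) := by simpa using h
    simpa using h1.comp_const_add (-t) t
  · intro h
    have h1 : HasDerivAt (fun s => f (glue i s v)) l (t + 0) := by simpa using h
    exact h1.comp_const_add t 0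

theorem lineDeriv_glue {d : ℕ} (f : E d → ℝ) (i : Fin d) (t : ℝ)
    (v : {j : Fin d // j ≠ i} → ℝ) :
    lineDeriv ℝ f (glue i t v) (e i) = deriv (fun s => f (glue i s v)) t := by
  have : (fun s : ℝ => f (glue i t v + s • e i)) = fun s => f (glue i (t + s) v) := by
    funext s; rw [glue_add]
  rw [lineDeriv, this, deriv_comp_const_add (fun s => f (glue i s v))]
  simp

theorem ae_of_ae_line {d : ℕ} (i : Fin d) {P : E d → Prop}
    (h : ∀ᵐ v : {j : Fin d // j ≠ i} → ℝ, ∀ t, P (glue i t v)) : ∀ᵐ x, P x := by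
  have h1 : ∀ᵐ z : ℝ × ({j : Fin d // j ≠ i} → ℝ) ∂(volume.prod volume), P (glue i z.1 z.2) := by
    have := (Measure.quasiMeasurePreserving_snd (μ := (volume : Measure ℝ))
      (ν := (volume : Measure ({j : Fin d // j ≠ i} → ℝ)))).ae h
    filter_upwards [this] with z hz using hz z.1
  have h2 := (measurePreserving_glue i).symm.quasiMeasurePreserving.ae h1
  filter_upwards [h2] with x hx
  have h3 : glue i ((glueEquiv i).symm x).1 ((glueEquiv i).symm x).2 = x :=
    (glueEquiv i).apply_symm_apply x
  rwa [h3] at hx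

theorem ae_line_of_ae {d : ℕ} (i : Fin d) {P : E d → Prop} (h : ∀ᵐ x, P x) :
    ∀ᵐ v : {j : Fin d // j ≠ i} → ℝ, ∀ᵐ t : ℝ, P (glue i t v) := by
  have h1 := (measurePreserving_glue i).quasiMeasurePreserving.ae h
  have h2 := (Measure.measurePreserving_swap (μ := (volume : Measure ({j : Fin d // j ≠ i} → ℝ)))
    (ν := (volume : Measure ℝ))).quasiMeasurePreserving.ae h1
  exact Measure.ae_ae_of_ae_prod h2


/-- Fubini for null sets. Measurability of `P` matters here, in contrast with `ae_of_ae_line`, where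
the exceptional set lies in a null cylinder. -/
theorem ae_of_ae_ae_line {d : ℕ} (i : Fin d) {P : E d → Prop} (hP : MeasurableSet {x | P x})
    (h : ∀ᵐ v : {j : Fin d // j ≠ i} → ℝ, ∀ᵐ t : ℝ, P (glue i t v)) : ∀ᵐ x, P x := by
  have hP' : MeasurableSet {z : ({j : Fin d // j ≠ i} → ℝ) × ℝ | P (glue i z.2 z.1)} :=
    ((continuous_glue i).measurable.comp measurable_swap) hP
  have h1 := (Measure.ae_prod_iff_ae_ae (μ := (volume : Measure ({j : Fin d // j ≠ i} → ℝ)))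
    (ν := (volume : Measure ℝ)) hP').2 h
  have h2 := (Measure.measurePreserving_swap (μ := (volume : Measure ℝ))
    (ν := (volume : Measure ({j : Fin d // j ≠ i} → ℝ)))).quasiMeasurePreserving.ae h1
  have h3 := (measurePreserving_glue i).symm.quasiMeasurePreserving.ae h2
  filter_upwards [h3] with x hx
  have h4 : glue i ((glueEquiv i).symm x).1 ((glueEquiv i).symm x).2 = x :=
    (glueEquiv i).apply_symm_apply x
  simp only [Prod.fst_swap, Prod.snd_swap] at hx
  rwa [h4] at hx

/-- The filter of nonzero rational numbers tending to `0`. -/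
def ratPunctured : Filter ℚ := comap (fun h : ℚ => (h : ℝ)) (𝓝[≠] 0)

instance : ratPunctured.IsCountablyGenerated := by
  unfold ratPunctured; infer_instance

theorem dense_range_rat_punctured {δ : ℝ} {s : ℝ} (hs : s ∈ Set.Ioo (-δ) δ) (hs0 : s ≠ 0) :
    s ∈ closure ({x : ℝ | ∃ h : ℚ, (h : ℝ) = x} ∩ (Set.Ioo (-δ) δ ∩ {0}ᶜ)) := by
  have hd : Dense {x : ℝ | ∃ h : ℚ, (h : ℝ) = x} := Rat.isDenseEmbedding_coe_real.dense
  have ho : IsOpen (Set.Ioo (-δ) δ ∩ ({0}ᶜ : Set ℝ)) := isOpen_Ioo.inter isOpen_compl_singleton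
  rw [Set.inter_comm]
  exact hd.open_subset_closure_inter ho ⟨hs, hs0⟩

instance : ratPunctured.NeBot := by
  unfold ratPunctured
  rw [comap_neBot_iff]
  intro t ht
  rw [mem_nhdsWithin_iff_exists_mem_nhds_inter] at ht
  obtain ⟨u, hu, hut⟩ := ht
  obtain ⟨δ, hδ, hb⟩ := Metric.mem_nhds_iff.1 hu
  obtain ⟨q, hq0, hqd⟩ := exists_rat_btwn hδ
  refine ⟨q, hut ⟨hb ?_, ?_⟩⟩
  · simp only [Metric.mem_ball, dist_zero_right, Real.norm_eq_abs]
    rwa [abs_of_pos hq0]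
  · exact hq0.ne'

/-- A closed ball around `c` that contains the values of `g` at small nonzero rationals contains all
values nearby, by density and continuity. Existence and value of a derivative can thus be read off
from countably many difference quotients, which is what measurability requires. -/
theorem tendsto_punctured_of_tendsto_rat {g : ℝ → ℝ} {c : ℝ} {ε : ℝ} (hε : 0 < ε)
    (hg : ContinuousOn g (Set.Ioo (-ε) ε ∩ {0}ᶜ))
    (h : Tendsto (fun h : ℚ => g h) ratPunctured (𝓝 c)) : Tendsto g (𝓝[≠] 0) (𝓝 c) := by
  rw [Metric.nhds_basis_closedBall.tendsto_right_iff] at h ⊢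
  intro r hr
  have h1 := h r hr
  rw [ratPunctured, eventually_comap, eventually_nhdsWithin_iff,
    Metric.eventually_nhds_iff] at h1
  obtain ⟨δ, hδ, h1⟩ := h1
  rw [eventually_nhdsWithin_iff, Metric.eventually_nhds_iff]
  refine ⟨min δ ε, lt_min hδ hε, fun s hs hs0 => ?_⟩
  have hs' : s ∈ Set.Ioo (-(min δ ε)) (min δ ε) := by
    rwa [dist_zero_right, Real.norm_eq_abs, abs_lt] at hs
  have hcl := dense_range_rat_punctured hs' hs0
  have hsub : Set.Ioo (-(min δ ε)) (min δ ε) ⊆ Set.Ioo (-ε) ε :=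
    Set.Ioo_subset_Ioo (neg_le_neg (min_le_right _ _)) (min_le_right _ _)
  have hca : ContinuousAt g s := hg.continuousAt
    ((isOpen_Ioo.inter isOpen_compl_singleton).mem_nhds ⟨hsub hs', hs0⟩)
  have := hca.continuousWithinAt.mem_closure hcl (t := Metric.closedBall c r) ?_
  · rwa [Metric.isClosed_closedBall.closure_eq] at this
  · rintro x ⟨⟨q, rfl⟩, hx, hx0⟩
    refine h1 ?_ hx0 q rfl
    rw [dist_zero_right, Real.norm_eq_abs, abs_lt]
    exact ⟨lt_of_le_of_lt (neg_le_neg (min_le_left _ _)) hx.1, hx.2.trans_le (min_le_left _ _)⟩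

/-- Closed intervals with rational endpoints generate the neighbourhoods in an open section. -/
theorem exists_rat_Icc_subset {O : Set ℝ} (hO : IsOpen O) {t : ℝ} (ht : t ∈ O) :
    ∃ a b : ℚ, (a : ℝ) < t ∧ t < b ∧ Set.Icc (a : ℝ) b ⊆ O := by
  obtain ⟨δ, hδ, hb⟩ := Metric.isOpen_iff.1 hO t ht
  obtain ⟨a, ha1, ha2⟩ := exists_rat_btwn (show t - δ < t by linarith)
  obtain ⟨b, hb1, hb2⟩ := exists_rat_btwn (show t < t + δ by linarith)
  refine ⟨a, b, ha2, hb1, fun s hs => hb ?_⟩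
  rw [Metric.mem_ball, Real.dist_eq, abs_lt]
  constructor <;> linarith [hs.1, hs.2]

theorem isOpen_section {d : ℕ} {U : Set (E d)} (hU : IsOpen U) (i : Fin d)
    (v : {j : Fin d // j ≠ i} → ℝ) : IsOpen {t : ℝ | glue i t v ∈ U} :=
  hU.preimage ((continuous_glue i).comp (Continuous.prodMk_left v))

/-! ### Partial derivatives of nice functions -/

variable {d : ℕ} {U : Set (E d)} {φ : E d → ℝ}

theorem IsNice.ae_differentiableAt_line (hU : IsOpen U) (hn : IsNice U φ) (i : Fin d) :
    ∀ᵐ v : {j : Fin d // j ≠ i} → ℝ, ∀ᵐ t : ℝ, glue i t v ∈ U →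
      DifferentiableAt ℝ (fun s => φ (glue i s v)) t := by
  filter_upwards [hn i] with v hv
  -- Absolute continuity gives a null set for each compact interval; rational endpoints leave only
  -- countably many intervals, and these cover the open section.
  have h1 : ∀ᵐ t : ℝ, ∀ a b : ℚ, (a : ℝ) ≤ b → (Set.Icc (a : ℝ) b ⊆ {t | glue i t v ∈ U}) →
      t ∈ Set.uIcc (a : ℝ) b → DifferentiableAt ℝ (fun s => φ (glue i s v)) t := by
    rw [ae_all_iff]; intro a
    rw [ae_all_iff]; intro b
    by_cases hab : (a : ℝ) ≤ b ∧ (Set.Icc (a : ℝ) b ⊆ {t | glue i t v ∈ U})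
    · filter_upwards [(hv a b hab.1 hab.2).ae_differentiableAt] with t ht _ _ using ht
    · exact Eventually.of_forall fun t h1 h2 => (hab ⟨h1, h2⟩).elim
  filter_upwards [h1] with t ht htU
  obtain ⟨a, b, ha, hb, hs⟩ := exists_rat_Icc_subset (isOpen_section hU i v) htU
  refine ht a b (ha.trans hb).le hs ?_
  rw [Set.uIcc_of_le (ha.trans hb).le]
  exact ⟨ha.le, hb.le⟩

theorem IsNice.ae_continuousOn_line (hU : IsOpen U) (hn : IsNice U φ) (i : Fin d) :
    ∀ᵐ x : E d, x ∈ U → ∃ ε > 0, ContinuousOn (fun s : ℝ => φ (x + s • e i)) (Set.Ioo (-ε) ε) := by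
  refine ae_of_ae_line i ?_
  filter_upwards [hn i] with v hv t htU
  obtain ⟨a, b, ha, hb, hs⟩ := exists_rat_Icc_subset (isOpen_section hU i v) htU
  have hc := (hv a b (ha.trans hb).le hs).continuousOn
  rw [Set.uIcc_of_le (ha.trans hb).le] at hc
  refine ⟨min (t - a) (b - t), lt_min (by linarith) (by linarith), ?_⟩
  simp_rw [← glue_add]
  refine hc.comp (f := fun s => t + s) (by fun_prop) fun s hs => ?_
  have h1 := min_le_left (t - a) (b - t)
  have h2 := min_le_right (t - a) (b - t)
  constructor <;> linarith [hs.1, hs.2]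

/-- A nice function that is measurable up to null sets is almost everywhere partially
differentiable, with partial derivatives that are measurable up to null sets. -/
theorem IsNice.ae_lineDifferentiableAt_and_aemeasurable (hU : IsOpen U) (hn : IsNice U φ)
    (hm : AEMeasurable φ (volume.restrict U)) (i : Fin d) :
    (∀ᵐ x : E d, x ∈ U → LineDifferentiableAt ℝ φ x (e i)) ∧
      AEMeasurable (fun x => lineDeriv ℝ φ x (e i)) (volume.restrict U) := by
  have hφ : AEMeasurable (U.indicator φ) := (aemeasurable_indicator_iff hU.measurableSet).2 hm
  have hQ : ∀ h : ℚ, AEMeasurable fun x : E d =>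
      (h : ℝ)⁻¹ * (U.indicator φ (x + (h : ℝ) • e i) - U.indicator φ x) := by
    intro h
    have h1 : AEMeasurable fun x : E d => U.indicator φ (x + (h : ℝ) • e i) :=
      hφ.comp_quasiMeasurePreserving
        (measurePreserving_add_right volume ((h : ℝ) • e i)).quasiMeasurePreserving
    exact (h1.sub hφ).const_mul _
  -- Measurable versions of the rational difference quotients of `φ` extended by `0`. Since `φ` is
  -- measurable only up to null sets, the set of points where its derivative exists need not be
  -- measurable, whereas the convergence set of the `F h` is.
  choose F hFm hF using hQ
  have hFall : ∀ᵐ x : E d, ∀ h : ℚ,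
      (h : ℝ)⁻¹ * (U.indicator φ (x + (h : ℝ) • e i) - U.indicator φ x) = F h x :=
    ae_all_iff.2 hF
  have hA : MeasurableSet {x | ∃ c, Tendsto (fun h => F h x) ratPunctured (𝓝 c)} :=
    measurableSet_exists_tendsto hFm
  have hiff : ∀ᵐ x : E d, x ∈ U → ∀ c, HasLineDerivAt ℝ φ c x (e i) ↔
      Tendsto (fun h => F h x) ratPunctured (𝓝 c) := by
    filter_upwards [hFall, hn.ae_continuousOn_line hU i] with x hx hxc hxU c
    obtain ⟨ε, hε, hc⟩ := hxc hxU
    have hev : ∀ᶠ s : ℝ in 𝓝[≠] 0, s⁻¹ * (φ (x + s • e i) - φ x) =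
        s⁻¹ * (U.indicator φ (x + s • e i) - U.indicator φ x) := by
      have h1 : Tendsto (fun s : ℝ => x + s • (e i : E d)) (𝓝 0) (𝓝 x) := by
        have : Continuous fun s : ℝ => x + s • (e i : E d) := by fun_prop
        simpa using this.tendsto 0
      filter_upwards [(h1.eventually (hU.mem_nhds hxU)).filter_mono nhdsWithin_le_nhds] with s hs
      rw [Set.indicator_of_mem hs, Set.indicator_of_mem hxU]
    have hslope : HasLineDerivAt ℝ φ c x (e i) ↔
        Tendsto (fun s : ℝ => s⁻¹ * (φ (x + s • e i) - φ x)) (𝓝[≠] 0) (𝓝 c) := by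
      rw [HasLineDerivAt, hasDerivAt_iff_tendsto_slope_zero]
      simp
    rw [hslope]
    have hrat : Tendsto (fun h => F h x) ratPunctured (𝓝 c) ↔
        Tendsto (fun h : ℚ => (h : ℝ)⁻¹ * (φ (x + (h : ℝ) • e i) - φ x)) ratPunctured (𝓝 c) := by
      refine tendsto_congr' ?_
      have := tendsto_comap.eventually (f := fun h : ℚ => (h : ℝ)) hev
      filter_upwards [this] with h hh
      rw [hh, hx]
    rw [hrat]
    refine ⟨fun h => h.comp tendsto_comap, fun h =>
      tendsto_punctured_of_tendsto_rat (g := fun s : ℝ => s⁻¹ * (φ (x + s • e i) - φ x)) hε ?_ h⟩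
    refine ContinuousOn.mul (continuousOn_inv₀.mono Set.inter_subset_right) ?_
    exact (hc.mono Set.inter_subset_left).sub continuousOn_const
  -- Differentiability is known for almost every point of almost every line. Fubini passes from
  -- lines to the whole space, applied to the measurable convergence set of the `F h`.
  have hmem : ∀ᵐ x : E d, x ∈ U → x ∈ {x | ∃ c, Tendsto (fun h => F h x) ratPunctured (𝓝 c)} := by
    refine ae_of_ae_ae_line i ?_ ?_
    · have : {x : E d | x ∈ U → x ∈ {x | ∃ c, Tendsto (fun h => F h x) ratPunctured (𝓝 c)}} =
          Uᶜ ∪ {x | ∃ c, Tendsto (fun h => F h x) ratPunctured (𝓝 c)} := by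
        ext x; simp [imp_iff_not_or]
      rw [this]
      exact hU.measurableSet.compl.union hA
    · filter_upwards [hn.ae_differentiableAt_line hU i, ae_line_of_ae i hiff] with v hv1 hv2
      filter_upwards [hv1, hv2] with t ht1 ht2 htU
      exact ⟨_, (ht2 htU _).1 (hasLineDerivAt_glue_iff.2 (ht1 htU).hasDerivAt)⟩
  have hdiff : ∀ᵐ x : E d, x ∈ U → LineDifferentiableAt ℝ φ x (e i) := by
    filter_upwards [hmem, hiff] with x h1 h2 hxU
    obtain ⟨c, hc⟩ := h1 hxU
    exact ((h2 hxU c).2 hc).lineDifferentiableAt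
  refine ⟨hdiff, ?_⟩
  refine aemeasurable_of_tendsto_metrizable_ae ratPunctured
    (fun h => (hFm h).aemeasurable) ?_
  rw [ae_restrict_iff' hU.measurableSet]
  filter_upwards [hdiff, hiff] with x h1 h2 hxU
  exact (h2 hxU _).1 (h1 hxU).hasLineDerivAt


/-- If `F² ≤ A B` pointwise then `(∫ F)² ≤ (∫ A) (∫ B)`. -/
theorem sq_integral_le_of_sq_le {α : Type*} [MeasurableSpace α] {ν : Measure α} {F A B : α → ℝ}
    (hF : Integrable F ν) (hA : Integrable A ν) (hB : Integrable B ν) (hA0 : ∀ x, 0 ≤ A x)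
    (hB0 : ∀ x, 0 ≤ B x) (h : ∀ x, F x ^ 2 ≤ A x * B x) :
    (∫ x, F x ∂ν) ^ 2 ≤ (∫ x, A x ∂ν) * ∫ x, B x ∂ν := by
  -- `A t² + 2 F t + B` is nonnegative pointwise because `F² ≤ A B`; the integrated polynomial then
  -- has nonpositive discriminant.
  have key : ∀ t : ℝ, 0 ≤ (∫ x, A x ∂ν) * (t * t) + 2 * (∫ x, F x ∂ν) * t + ∫ x, B x ∂ν := by
    intro t
    have h1 : 0 ≤ ∫ x, (A x * (t * t) + F x * (2 * t) + B x) ∂ν := by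
      refine integral_nonneg fun x => ?_
      by_cases hx : A x = 0
      · have h2 := h x
        rw [hx, zero_mul] at h2
        have h3 : F x = 0 := by nlinarith
        simp only [Pi.zero_apply, hx, h3]
        linarith [hB0 x]
      · have hpos : 0 < A x := lt_of_le_of_ne (hA0 x) (Ne.symm hx)
        have h2 : 0 ≤ A x * (A x * (t * t) + F x * (2 * t) + B x) := by
          nlinarith [h x, sq_nonneg (A x * t + F x)]
        exact nonneg_of_mul_nonneg_right h2 hpos
    have h2 : Integrable (fun x => A x * (t * t) + F x * (2 * t)) ν :=
      (hA.mul_const _).add (hF.mul_const _)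
    rw [integral_add h2 hB, integral_add (hA.mul_const _) (hF.mul_const _), integral_mul_const, integral_mul_const] at h1
    linarith
  have := discrim_le_zero key
  rw [discrim] at this
  linarith

/-! ### Regular priors -/

section Prior

variable {p : ℕ} {q : E p → ℝ}

namespace IsRegularPrior

/-- Continuity extends the vanishing outside the ball to the sphere, which removes the boundary
terms in the integration by parts. -/
theorem eq_zero_of_one_le_norm (hq : IsRegularPrior q) {u : E p} (hu : 1 ≤ ‖u‖) : q u = 0 := by
  have h1 : Tendsto (fun t : ℝ => q (t • u)) (𝓝[>] 1) (𝓝 (q ((1 : ℝ) • u))) :=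
    ((hq.continuous.comp (continuous_id.smul continuous_const)).tendsto 1).mono_left
      nhdsWithin_le_nhds
  have h2 : Tendsto (fun t : ℝ => q (t • u)) (𝓝[>] 1) (𝓝 0) := by
    refine tendsto_const_nhds.congr' ?_
    filter_upwards [self_mem_nhdsWithin] with t ht
    refine (hq.eq_zero _ ?_).symm
    rw [norm_smul, Real.norm_of_nonneg (zero_le_one.trans (le_of_lt ht))]
    have : (1 : ℝ) < t := ht
    nlinarith
  simpa using tendsto_nhds_unique h1 h2

theorem mem_closedBall (hq : IsRegularPrior q) {u : E p} (hu : q u ≠ 0) :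
    u ∈ Metric.closedBall (0 : E p) 1 := by
  rw [mem_closedBall_zero_iff]
  by_contra h
  exact hu (hq.eq_zero u (not_le.1 h))

/-- A zero of the nonnegative `q` is a minimum along every line. If the derivative does not exist,
the default value of `lineDeriv` is `0` as well. -/
theorem lineDeriv_eq_zero (hq : IsRegularPrior q) {u : E p} (hu : q u = 0) (v : E p) :
    lineDeriv ℝ q u v = 0 := by
  refine IsLocalMin.deriv_eq_zero (f := fun t : ℝ => q (u + t • v)) ?_
  refine Eventually.of_forall fun t => ?_
  simp only [zero_smul, add_zero, hu]
  exact hq.nonneg _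

theorem integrable_self (hq : IsRegularPrior q) : Integrable q := by
  refine ⟨hq.continuous.aestronglyMeasurable, ?_⟩
  rw [hasFiniteIntegral_iff_ofReal (Eventually.of_forall hq.nonneg), hq.lintegral_eq_one]
  exact ENNReal.one_lt_top

theorem isProbabilityMeasure (hq : IsRegularPrior q) : IsProbabilityMeasure (priorMeasure q) := by
  constructor
  rw [priorMeasure, withDensity_apply _ MeasurableSet.univ, Measure.restrict_univ,
    hq.lintegral_eq_one]

theorem integrable_prior_iff (hq : IsRegularPrior q) {f : E p → ℝ} :
    Integrable f (priorMeasure q) ↔ Integrable fun u => f u * q u := by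
  rw [priorMeasure, integrable_withDensity_iff_integrable_smul'
    (hq.continuous.measurable.ennreal_ofReal) (Eventually.of_forall fun _ => ENNReal.ofReal_lt_top)]
  refine integrable_congr (Eventually.of_forall fun u => ?_)
  simp only [ENNReal.toReal_ofReal (hq.nonneg u), smul_eq_mul, mul_comm]

theorem integral_prior (hq : IsRegularPrior q) (f : E p → ℝ) :
    ∫ u, f u ∂(priorMeasure q) = ∫ u, f u * q u := by
  rw [priorMeasure, integral_withDensity_eq_integral_toReal_smul
    (hq.continuous.measurable.ennreal_ofReal) (Eventually.of_forall fun _ => ENNReal.ofReal_lt_top)]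
  refine integral_congr_ae (Eventually.of_forall fun u => ?_)
  simp only [ENNReal.toReal_ofReal (hq.nonneg u), smul_eq_mul, mul_comm]

theorem aestronglyMeasurable_mul (hq : IsRegularPrior q) {U : Set (E p)} (hU : MeasurableSet U)
    (hball : Metric.closedBall (0 : E p) 1 ⊆ U) {f : E p → ℝ}
    (hf : AEMeasurable f (volume.restrict U)) : AEStronglyMeasurable fun u => f u * q u := by
  have h1 : (fun u => f u * q u) = fun u => U.indicator f u * q u := by
    funext u
    by_cases hu : q u = 0
    · simp [hu]
    · rw [Set.indicator_of_mem (hball (hq.mem_closedBall hu))]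
  rw [h1]
  exact (((aemeasurable_indicator_iff hU).2 hf).mul
    hq.continuous.measurable.aemeasurable).aestronglyMeasurable

theorem measurable_lineDeriv (hq : IsRegularPrior q) (v : E p) :
    Measurable fun u => lineDeriv ℝ q u v :=
  _root_.measurable_lineDeriv hq.continuous

theorem measurableSet_pos (hq : IsRegularPrior q) : MeasurableSet {u | 0 < q u} :=
  measurableSet_lt measurable_const hq.continuous.measurable

theorem integrable_info (hq : IsRegularPrior q) (i j : Fin p) :
    Integrable fun u => {u | 0 < q u}.indicator
      (fun u => lineDeriv ℝ q u (e i) * lineDeriv ℝ q u (e j) / q u) u := by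
  refine hq.integrable.mono' ?_ (Eventually.of_forall fun u => ?_)
  · exact ((((hq.measurable_lineDeriv _).mul (hq.measurable_lineDeriv _)).div
      hq.continuous.measurable).indicator hq.measurableSet_pos).aestronglyMeasurable
  · by_cases hu : u ∈ {u | 0 < q u}
    · have hu' : 0 < q u := hu
      rw [Set.indicator_of_mem hu, Set.indicator_of_mem hu, norm_div, norm_mul,
        Real.norm_of_nonneg hu'.le]
      refine div_le_div_of_nonneg_right ?_ hu'.le
      simp only [Real.norm_eq_abs]
      have h1 : ∀ k, |lineDeriv ℝ q u (e k)| ^ 2 ≤ ∑ i, lineDeriv ℝ q u (e i) ^ 2 := by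
        intro k
        rw [sq_abs]
        exact Finset.single_le_sum (f := fun i => lineDeriv ℝ q u (e i) ^ 2)
          (fun i _ => sq_nonneg _) (Finset.mem_univ k)
      nlinarith [h1 i, h1 j, sq_nonneg (|lineDeriv ℝ q u (e i)| - |lineDeriv ℝ q u (e j)|)]
    · rw [Set.indicator_of_notMem hu, Set.indicator_of_notMem hu, norm_zero]

/-- With `x = |∂_i q| / q` where `q > 0`, the bound `x ≤ 1 + x²` gives `|∂_i q| ≤ q + (∂_i q)² / q`.
-/
theorem integrable_lineDeriv (hq : IsRegularPrior q) (i : Fin p) :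
    Integrable fun u => lineDeriv ℝ q u (e i) := by
  refine (hq.integrable_self.add (hq.integrable_info i i)).mono'
    (hq.measurable_lineDeriv _).aestronglyMeasurable (Eventually.of_forall fun u => ?_)
  simp only [Pi.add_apply, Real.norm_eq_abs]
  by_cases hu : u ∈ {u | 0 < q u}
  · have hu' : 0 < q u := hu
    rw [Set.indicator_of_mem hu]
    have h1 : lineDeriv ℝ q u (e i) * lineDeriv ℝ q u (e i) / q u =
        (|lineDeriv ℝ q u (e i)| / q u) ^ 2 * q u := by
      rw [div_pow, sq_abs]; field_simp
    rw [h1]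
    have h2 : |lineDeriv ℝ q u (e i)| = (|lineDeriv ℝ q u (e i)| / q u) * q u := by
      field_simp
    set x := |lineDeriv ℝ q u (e i)| / q u
    calc |lineDeriv ℝ q u (e i)| = x * q u := h2
      _ ≤ (1 + x ^ 2) * q u := by gcongr; nlinarith [sq_nonneg (x - 1), sq_nonneg x]
      _ = q u + x ^ 2 * q u := by ring
  · have h0 : q u = 0 := le_antisymm (not_lt.1 (fun h => hu h)) (hq.nonneg u)
    rw [Set.indicator_of_notMem hu, hq.lineDeriv_eq_zero h0, h0]
    simp

/-- Integration by parts against a regular prior. -/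
theorem integral_parts (hq : IsRegularPrior q) (i : Fin p) {u : E p → ℝ}
    (hline : ∀ᵐ v : {j : Fin p // j ≠ i} → ℝ, ∀ ρ : ℝ, 0 ≤ ρ →
      (∀ t ∈ Set.Icc (-ρ) ρ, glue i t v ∈ Metric.closedBall (0 : E p) 1) →
      AbsolutelyContinuousOnInterval (fun t => u (glue i t v) * q (glue i t v)) (-ρ) ρ ∧
        ∀ᵐ t : ℝ, t ∈ Set.Icc (-ρ) ρ → DifferentiableAt ℝ (fun s => u (glue i s v)) t)
    (hint : Integrable fun x => lineDeriv ℝ u x (e i) * q x + u x * lineDeriv ℝ q x (e i)) :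
    ∫ x, (lineDeriv ℝ u x (e i) * q x + u x * lineDeriv ℝ q x (e i)) = 0 := by
  set F : E p → ℝ := fun x => lineDeriv ℝ u x (e i) * q x + u x * lineDeriv ℝ q x (e i) with hF
  have hF0 : ∀ x, 1 ≤ ‖x‖ → F x = 0 := by
    intro x hx
    have h0 := hq.eq_zero_of_one_le_norm hx
    simp [hF, h0, hq.lineDeriv_eq_zero h0]
  rw [← (measurePreserving_glue i).integral_comp' F]
  have hint' : Integrable (fun z => F (glueEquiv i z)) (volume.prod volume) :=
    (measurePreserving_glue i).integrable_comp_emb (glueEquiv i).measurableEmbedding |>.2 hint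
  rw [integral_prod_symm _ hint']
  refine integral_eq_zero_of_ae ?_
  filter_upwards [hline, hq.nice i] with v hv hqv
  change ∫ t, F (glue i t v) = 0
  set S := ∑ j, v j ^ 2 with hS
  -- If the line misses the closed ball, the integrand vanishes along it.
  by_cases hS1 : 1 < S
  · refine integral_eq_zero_of_ae (Eventually.of_forall fun t => hF0 _ ?_)
    have := norm_glue_sq i t v
    rw [← hS] at this
    nlinarith [norm_nonneg (glue i t v), sq_nonneg t]
  · push Not at hS1
    -- Half the length of the chord cut by the closed unit ball. Its endpoints lie on the sphere,
    -- where `q = 0`.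
    set ρ := √(1 - S)
    have hρ0 : 0 ≤ ρ := Real.sqrt_nonneg _
    have hρ : ρ ^ 2 = 1 - S := Real.sq_sqrt (by linarith)
    have hnorm : ∀ t, ‖glue i t v‖ ^ 2 = t ^ 2 + (1 - ρ ^ 2) := by
      intro t; rw [norm_glue_sq, hρ]; ring
    have hmem : ∀ t ∈ Set.Icc (-ρ) ρ, glue i t v ∈ Metric.closedBall (0 : E p) 1 := by
      intro t ht
      rw [mem_closedBall_zero_iff]
      have h1 := abs_le.2 ht
      have h2 := hnorm t
      have h3 : t ^ 2 ≤ ρ ^ 2 := sq_le_sq' ht.1 ht.2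
      nlinarith [norm_nonneg (glue i t v)]
    have hout : ∀ t, ρ ≤ |t| → 1 ≤ ‖glue i t v‖ := by
      intro t ht
      have h2 := hnorm t
      have h3 : ρ ^ 2 ≤ t ^ 2 := by rw [← sq_abs t]; gcongr
      nlinarith [norm_nonneg (glue i t v)]
    obtain ⟨hac, hdiff⟩ := hv ρ hρ0 hmem
    have hqac := hqv (-ρ) ρ (by linarith) (fun _ _ => Set.mem_univ _)
    have hsupp : Function.support (fun t => F (glue i t v)) ⊆ Set.Ioc (-ρ) ρ := by
      intro t ht
      by_contra hcon
      refine ht (hF0 _ (hout t ?_))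
      by_contra hlt
      rw [not_le, abs_lt] at hlt
      exact hcon ⟨hlt.1, hlt.2.le⟩
    rw [← intervalIntegral.integral_eq_integral_of_support_subset hsupp]
    have hder : ∫ t in (-ρ)..ρ, F (glue i t v) =
        ∫ t in (-ρ)..ρ, deriv (fun t => u (glue i t v) * q (glue i t v)) t := by
      refine intervalIntegral.integral_congr_ae ?_
      filter_upwards [hdiff, hqac.ae_differentiableAt] with t ht1 ht2 ht
      have ht' := Set.uIoc_subset_uIcc ht
      have h2 := ht2 ht'
      rw [Set.uIcc_of_le (by linarith)] at ht'
      rw [((ht1 ht').hasDerivAt.fun_mul h2.hasDerivAt).deriv]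
      simp only [hF, lineDeriv_glue]
    rw [hder, hac.integral_deriv_eq_sub,
      hq.eq_zero_of_one_le_norm (hout ρ (le_abs_self _)),
      hq.eq_zero_of_one_le_norm (hout (-ρ) (by rw [abs_neg]; exact le_abs_self _))]
    simp

theorem integral_parts_of_isNice (hq : IsRegularPrior q) (i : Fin p) {U : Set (E p)}
    (hU : IsOpen U) (hball : Metric.closedBall (0 : E p) 1 ⊆ U) {φ : E p → ℝ} (hφ : IsNice U φ)
    (hint : Integrable fun x => lineDeriv ℝ φ x (e i) * q x + φ x * lineDeriv ℝ q x (e i)) :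
    ∫ x, (lineDeriv ℝ φ x (e i) * q x + φ x * lineDeriv ℝ q x (e i)) = 0 := by
  refine hq.integral_parts i ?_ hint
  filter_upwards [hφ i, hq.nice i, hφ.ae_differentiableAt_line hU i] with v h1 h2 h3 ρ hρ hb
  refine ⟨(h1 (-ρ) ρ (by linarith) fun t ht => hball (hb t ht)).fun_mul
    (h2 (-ρ) ρ (by linarith) fun _ _ => Set.mem_univ _), ?_⟩
  filter_upwards [h3] with t ht htI using ht (hball (hb t htI))

/-- Meant for the mean of a statistic: `m` has a partial derivative at every point of the ball,
integrable only against `q`, so `m` itself need not be absolutely continuous on chords. The product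
`m q` is. -/
theorem integral_parts_of_lineDifferentiableAt (hq : IsRegularPrior q) (i : Fin p)
    {m : E p → ℝ} {C : ℝ} (hmC : ∀ x ∈ Metric.closedBall (0 : E p) 1, |m x| ≤ C)
    (hm : ∀ x ∈ Metric.closedBall (0 : E p) 1, LineDifferentiableAt ℝ m x (e i))
    (hmq : Integrable fun x => lineDeriv ℝ m x (e i) * q x)
    (hint : Integrable fun x => lineDeriv ℝ m x (e i) * q x + m x * lineDeriv ℝ q x (e i)) :
    ∫ x, (lineDeriv ℝ m x (e i) * q x + m x * lineDeriv ℝ q x (e i)) = 0 := by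
  refine hq.integral_parts i ?_ hint
  have hline : ∀ᵐ v : {j : Fin p // j ≠ i} → ℝ,
      Integrable fun t => lineDeriv ℝ m (glue i t v) (e i) * q (glue i t v) := by
    have : Integrable (fun z => (fun x => lineDeriv ℝ m x (e i) * q x) (glueEquiv i z))
        (volume.prod volume) :=
      (measurePreserving_glue i).integrable_comp_emb (glueEquiv i).measurableEmbedding |>.2 hmq
    exact this.prod_left_ae
  filter_upwards [hline, hq.nice i] with v h1 h2 ρ hρ hb
  have hd : ∀ t ∈ Set.Icc (-ρ) ρ, HasDerivAt (fun s => m (glue i s v))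
      (lineDeriv ℝ m (glue i t v) (e i)) t := fun t ht =>
    hasLineDerivAt_glue_iff.1 (hm _ (hb t ht)).hasLineDerivAt
  refine ⟨?_, Eventually.of_forall fun t ht => (hd t ht).differentiableAt⟩
  exact absolutelyContinuousOnInterval_mul_of_hasDerivAt (by linarith) hd
    (fun t ht => hmC _ (hb t ht)) (h2 (-ρ) ρ (by linarith) fun _ _ => Set.mem_univ _)
    (fun t => hq.nonneg _) h1.intervalIntegrable

end IsRegularPrior

end Prior


/-- As the derivative exists at every point of `U`, the difference quotients along the single
sequence `1 / (k + 1)` suffice. -/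
theorem aemeasurable_lineDeriv_of_lineDifferentiableAt {p : ℕ} {U : Set (E p)} (hU : IsOpen U)
    {m : E p → ℝ} (hm : AEMeasurable m (volume.restrict U)) (v : E p)
    (hd : ∀ x ∈ U, LineDifferentiableAt ℝ m x v) :
    AEMeasurable (fun x => lineDeriv ℝ m x v) (volume.restrict U) := by
  have hφ : AEMeasurable (U.indicator m) := (aemeasurable_indicator_iff hU.measurableSet).2 hm
  have hs : Tendsto (fun k : ℕ => (1 : ℝ) / (k + 1)) atTop (𝓝[≠] 0) := by
    rw [tendsto_nhdsWithin_iff]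
    exact ⟨tendsto_one_div_add_atTop_nhds_zero_nat,
      Eventually.of_forall fun k => (Nat.one_div_pos_of_nat (α := ℝ)).ne'⟩
  refine aemeasurable_of_tendsto_metrizable_ae atTop (f := fun (k : ℕ) x =>
    ((1 : ℝ) / (k + 1))⁻¹ * (U.indicator m (x + ((1 : ℝ) / (k + 1)) • v) - U.indicator m x)) ?_ ?_
  · intro k
    refine AEMeasurable.restrict ?_
    have h1 : AEMeasurable fun x : E p => U.indicator m (x + ((1 : ℝ) / (k + 1)) • v) :=
      hφ.comp_quasiMeasurePreserving
        (measurePreserving_add_right volume (((1 : ℝ) / (k + 1)) • v)).quasiMeasurePreserving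
    exact (h1.sub hφ).const_mul _
  · rw [ae_restrict_iff' hU.measurableSet]
    refine Eventually.of_forall fun x hx => ?_
    have h1 := (hasDerivAt_iff_tendsto_slope_zero.1 (hd x hx).hasLineDerivAt).comp hs
    refine h1.congr' ?_
    have h2 : Tendsto (fun k : ℕ => x + ((1 : ℝ) / (k + 1)) • v) atTop (𝓝 x) := by
      have : Continuous fun s : ℝ => x + s • v := by fun_prop
      simpa [Function.comp_def] using (this.tendsto 0).comp (tendsto_nhdsWithin_iff.1 hs).1
    filter_upwards [h2.eventually (hU.mem_nhds hx)] with k hk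
    simp only [Function.comp_apply, zero_add, zero_smul, add_zero, smul_eq_mul]
    rw [Set.indicator_of_mem hk, Set.indicator_of_mem hx]

/-! ### The van Trees inequality -/

section VanTrees

variable {p : ℕ} {q : E p → ℝ}

/-- The **van Trees inequality**, in terms of the mean `m` of a bounded statistic, of the target
`φ`, of a bound `R` on the quadratic risk and of the information `V`. -/
theorem IsRegularPrior.vanTrees (hq : IsRegularPrior q) {U : Set (E p)} (hU : IsOpen U)
    (hball : Metric.closedBall (0 : E p) 1 ⊆ U) {m φ R : E p → ℝ}
    {V : E p → Matrix (Fin p) (Fin p) ℝ} {C D : ℝ}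
    (hm : AEMeasurable m (volume.restrict U)) (hmC : ∀ x ∈ U, |m x| ≤ C)
    (hmd : ∀ x ∈ U, ∀ i, LineDifferentiableAt ℝ m x (e i))
    (hφ : AEMeasurable φ (volume.restrict U)) (hφC : ∀ x ∈ U, |φ x| ≤ C)
    (hφn : IsNice U φ)
    (hφD : ∀ i, ∀ᵐ x ∂(volume.restrict U), |lineDeriv ℝ φ x (e i)| ≤ D)
    (hV : ∀ i j, Integrable (fun x => V x i j) (priorMeasure q))
    (hV0 : ∀ x ∈ U, ∀ w, 0 ≤ w ⬝ᵥ V x *ᵥ w)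
    (hR : Integrable R (priorMeasure q))
    (hineq : ∀ x ∈ U, ∀ (w : Fin p → ℝ) (β : ℝ),
      (∑ i, w i * lineDeriv ℝ m x (e i) + β * (m x - φ x)) ^ 2 ≤
        R x * (w ⬝ᵥ V x *ᵥ w + β ^ 2)) (w : Fin p → ℝ) :
    (∑ i, w i * ∫ x, lineDeriv ℝ φ x (e i) ∂(priorMeasure q)) ^ 2 ≤
      (∫ x, R x ∂(priorMeasure q)) *
        (w ⬝ᵥ (priorInfo q + Matrix.of fun i j => ∫ x, V x i j ∂(priorMeasure q)) *ᵥ w) := by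
  have hUm := hU.measurableSet
  have hRq := hq.integrable_prior_iff.1 hR
  have hVq := fun i j => hq.integrable_prior_iff.1 (hV i j)
  have hmemU : ∀ {x}, q x ≠ 0 → x ∈ U := fun hx => hball (hq.mem_closedBall hx)
  have hR0 : ∀ x ∈ U, 0 ≤ R x := by
    intro x hx
    have := hineq x hx 0 1
    simp only [Pi.zero_apply, zero_mul, Finset.sum_const_zero, zero_add, one_mul,
      zero_dotProduct, one_pow, mul_one] at this
    exact (sq_nonneg _).trans this
  -- integrability of the products
  have hbd : ∀ {f : E p → ℝ}, AEMeasurable f (volume.restrict U) → (∀ x ∈ U, |f x| ≤ C) → ∀ i,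
      Integrable fun x => f x * lineDeriv ℝ q x (e i) := by
    intro f hf hfC i
    have h1 : (fun x => f x * lineDeriv ℝ q x (e i)) =
        fun x => U.indicator f x * lineDeriv ℝ q x (e i) := by
      funext x
      by_cases hx : q x = 0
      · simp [hq.lineDeriv_eq_zero hx]
      · rw [Set.indicator_of_mem (hmemU hx)]
    rw [h1]
    refine ((hq.integrable_lineDeriv i).norm.const_mul |C|).mono'
      (((aemeasurable_indicator_iff hUm).2 hf).mul
        (hq.measurable_lineDeriv _).aemeasurable).aestronglyMeasurable
      (Eventually.of_forall fun x => ?_)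
    rw [norm_mul]
    gcongr
    by_cases hx : x ∈ U
    · rw [Set.indicator_of_mem hx]; exact (hfC x hx).trans (le_abs_self C)
    · rw [Set.indicator_of_notMem hx, norm_zero]; exact abs_nonneg C
  have hmq : ∀ i, Integrable fun x => lineDeriv ℝ m x (e i) * q x := by
    intro i
    refine (hRq.add (hVq i i)).mono' (hq.aestronglyMeasurable_mul hUm hball
      (aemeasurable_lineDeriv_of_lineDifferentiableAt hU hm _ fun x hx => hmd x hx i))
      (Eventually.of_forall fun x => ?_)
    by_cases hx : q x = 0
    · simp [hx]
    · have hxU := hmemU hx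
      -- With `w` the `i`-th basis vector and `β = 0`, `(∂_i m)² ≤ R V_ii ≤ (R + V_ii)²`, so that `R
      -- + V_ii` dominates `|∂_i m|`.
      have h1 := hineq x hxU (Pi.single i 1) 0
      have h2 := hV0 x hxU (Pi.single i 1)
      simp only [Pi.single_apply, ite_mul, one_mul, zero_mul, Finset.sum_ite_eq', Finset.mem_univ,
        if_true, add_zero, single_one_dotProduct, Matrix.mulVec_single_one, Matrix.col_apply,
        ne_eq, OfNat.ofNat_ne_zero, not_false_eq_true, zero_pow] at h1 h2
      have h3 := hR0 x hxU
      rw [norm_mul, Real.norm_of_nonneg (hq.nonneg x), Real.norm_eq_abs, Pi.add_apply, ← add_mul]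
      refine mul_le_mul_of_nonneg_right ?_ (hq.nonneg x)
      refine abs_le_of_sq_le_sq (h1.trans ?_) (by positivity)
      nlinarith
  have hφq : ∀ i, Integrable fun x => lineDeriv ℝ φ x (e i) * q x := by
    intro i
    refine (hq.integrable_self.const_mul |D|).mono' (hq.aestronglyMeasurable_mul hUm hball
      (hφn.ae_lineDifferentiableAt_and_aemeasurable hU hφ i).2) ?_
    filter_upwards [(ae_restrict_iff' hUm).1 (hφD i)] with x hx
    by_cases h0 : q x = 0
    · simp [h0]
    · rw [norm_mul, Real.norm_of_nonneg (hq.nonneg x), Real.norm_eq_abs]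
      exact mul_le_mul_of_nonneg_right ((hx (hmemU h0)).trans (le_abs_self D)) (hq.nonneg x)
  -- integration by parts
  have hparts : ∀ i, ∫ x, lineDeriv ℝ φ x (e i) ∂(priorMeasure q) =
      ∫ x, (lineDeriv ℝ m x (e i) * q x + (m x - φ x) * lineDeriv ℝ q x (e i)) := by
    intro i
    have h1 := hq.integral_parts_of_isNice i hU hball hφn ((hφq i).add (hbd hφ hφC i))
    have h2 := hq.integral_parts_of_lineDifferentiableAt i (fun x hx => hmC x (hball hx))
      (fun x hx => hmd x (hball hx) i) (hmq i) ((hmq i).add (hbd hm hmC i))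
    rw [integral_add (hφq i) (hbd hφ hφC i)] at h1
    rw [integral_add (hmq i) (hbd hm hmC i)] at h2
    have h3 : ∫ x, (m x - φ x) * lineDeriv ℝ q x (e i) =
        (∫ x, m x * lineDeriv ℝ q x (e i)) - ∫ x, φ x * lineDeriv ℝ q x (e i) := by
      rw [← integral_sub (hbd hm hmC i) (hbd hφ hφC i)]
      simp only [sub_mul]
    have h4 : Integrable fun x => (m x - φ x) * lineDeriv ℝ q x (e i) := by
      simpa only [sub_mul] using! (hbd hm hmC i).sub (hbd hφ hφC i)
    rw [hq.integral_prior, integral_add (hmq i) h4, h3]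
    linarith
  have hIi : ∀ i, Integrable fun x =>
      lineDeriv ℝ m x (e i) * q x + (m x - φ x) * lineDeriv ℝ q x (e i) := by
    intro i
    have h4 : Integrable fun x => (m x - φ x) * lineDeriv ℝ q x (e i) := by
      simpa only [sub_mul] using! (hbd hm hmC i).sub (hbd hφ hφC i)
    exact (hmq i).add h4
  -- `F` and `B` are the integrands of the linear form on the left and of the quadratic form on the
  -- right. It remains to prove `F² ≤ (R q) B` pointwise.
  set F : E p → ℝ := fun x => ∑ i, w i *
    (lineDeriv ℝ m x (e i) * q x + (m x - φ x) * lineDeriv ℝ q x (e i)) with hF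
  set B : E p → ℝ := fun x => ∑ i, ∑ j, (w i * w j) * ({u | 0 < q u}.indicator
      (fun u => lineDeriv ℝ q u (e i) * lineDeriv ℝ q u (e j) / q u) x + V x i j * q x) with hB
  have hFint : Integrable F := integrable_finsetSum _ fun i _ => (hIi i).const_mul _
  have hBi : ∀ i j, Integrable fun x => (w i * w j) * ({u | 0 < q u}.indicator
      (fun u => lineDeriv ℝ q u (e i) * lineDeriv ℝ q u (e j) / q u) x + V x i j * q x) :=
    fun i j => ((hq.integrable_info i j).add (hVq i j)).const_mul _
  have hBint : Integrable B :=
    integrable_finsetSum _ fun i _ => integrable_finsetSum _ fun j _ => hBi i j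
  have hFI : ∑ i, w i * ∫ x, lineDeriv ℝ φ x (e i) ∂(priorMeasure q) = ∫ x, F x := by
    rw [integral_finsetSum _ fun i _ => (hIi i).const_mul _]
    simp only [integral_const_mul, hparts]
  have hBI : w ⬝ᵥ (priorInfo q + Matrix.of fun i j => ∫ x, V x i j ∂(priorMeasure q)) *ᵥ w =
      ∫ x, B x := by
    rw [integral_finsetSum _ fun i _ => integrable_finsetSum _ fun j _ => hBi i j]
    simp only [dotProduct, Matrix.mulVec, Finset.mul_sum]
    refine Finset.sum_congr rfl fun i _ => ?_
    rw [integral_finsetSum _ fun j _ => hBi i j]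
    refine Finset.sum_congr rfl fun j _ => ?_
    rw [integral_const_mul, integral_add (hq.integrable_info i j) (hVq i j)]
    simp only [Matrix.add_apply, priorInfo, Matrix.of_apply, hq.integral_prior]
    ring
  have hBpos : ∀ x, 0 < q x → B x = q x * (w ⬝ᵥ V x *ᵥ w +
      ((∑ i, w i * lineDeriv ℝ q x (e i)) / q x) ^ 2) := by
    intro x hx
    have h1 : ∀ i j, {u | 0 < q u}.indicator
        (fun u => lineDeriv ℝ q u (e i) * lineDeriv ℝ q u (e j) / q u) x =
        lineDeriv ℝ q x (e i) * lineDeriv ℝ q x (e j) / q x := fun i j =>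
      Set.indicator_of_mem (s := {u | 0 < q u}) hx _
    simp only [hB, h1, dotProduct, Matrix.mulVec, div_pow]
    rw [sq (∑ i, w i * lineDeriv ℝ q x (e i)), Finset.sum_mul_sum, mul_add, Finset.mul_sum,
      Finset.sum_div, Finset.mul_sum, ← Finset.sum_add_distrib]
    refine Finset.sum_congr rfl fun i _ => ?_
    rw [Finset.mul_sum, Finset.mul_sum, Finset.sum_div, Finset.mul_sum, ← Finset.sum_add_distrib]
    refine Finset.sum_congr rfl fun j _ => ?_
    field_simp
    ring
  have hBzero : ∀ x, q x = 0 → B x = 0 := by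
    intro x hx
    simp [hB, hx]
  rw [hFI, hBI, hq.integral_prior]
  have hq0 : ∀ x, q x = 0 ∨ 0 < q x := fun x => (hq.nonneg x).eq_or_lt.imp Eq.symm id
  refine sq_integral_le_of_sq_le hFint hRq hBint ?_ ?_ ?_
  · intro x
    rcases hq0 x with h | h
    · simp [h]
    · exact mul_nonneg (hR0 x (hmemU h.ne')) h.le
  · intro x
    rcases hq0 x with h | h
    · rw [hBzero x h]
    · rw [hBpos x h]
      exact mul_nonneg h.le (add_nonneg (hV0 x (hmemU h.ne') w) (sq_nonneg _))
  · intro x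
    rcases hq0 x with h | h
    · simp [hF, h, hq.lineDeriv_eq_zero h]
    · have h1 := hineq x (hmemU h.ne') w ((∑ i, w i * lineDeriv ℝ q x (e i)) / q x)
      have h2 : F x = q x * (∑ i, w i * lineDeriv ℝ m x (e i) +
          (∑ i, w i * lineDeriv ℝ q x (e i)) / q x * (m x - φ x)) := by
        simp only [hF]
        rw [mul_add, ← mul_assoc, mul_div_cancel₀ _ h.ne', Finset.mul_sum, Finset.sum_mul,
          ← Finset.sum_add_distrib]
        exact Finset.sum_congr rfl fun i _ => by ring
      rw [h2, hBpos x h, mul_pow]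
      nlinarith [mul_le_mul_of_nonneg_left h1 (sq_nonneg (q x))]

end VanTrees


/-! ### Tensor powers of `L²` functions -/

section Tensor

variable {X : Type*} [MeasurableSpace X] {μ : Measure X} {n : ℕ}

theorem prod_update_eval (m : Fin n → Lp ℝ 2 μ) (k : Fin n) (a : Lp ℝ 2 μ) (x : Fin n → X) :
    ∏ j, (Function.update m k a j : X → ℝ) (x j) =
      a (x k) * ∏ j ∈ Finset.univ.erase k, m j (x j) := by
  rw [← Finset.mul_prod_erase _ _ (Finset.mem_univ k), Function.update_self]
  congr 1
  refine Finset.prod_congr rfl fun j hj => ?_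
  rw [Function.update_of_ne (Finset.ne_of_mem_erase hj)]

variable [SigmaFinite μ]

theorem memLp_two_prod_pi {f : Fin n → X → ℝ} (hf : ∀ k, MemLp (f k) 2 μ) :
    MemLp (fun x : Fin n → X => ∏ k, f k (x k)) 2 (Measure.pi fun _ => μ) := by
  have hm : AEStronglyMeasurable (fun x : Fin n → X => ∏ k, f k (x k))
      (Measure.pi fun _ => μ) := by
    refine Finset.aestronglyMeasurable_fun_prod _ fun k _ => ?_
    exact (hf k).1.comp_quasiMeasurePreserving (Measure.quasiMeasurePreserving_eval (fun _ => μ) k)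
  rw [memLp_two_iff_integrable_sq hm]
  simp only [← Finset.prod_pow]
  exact Integrable.fintype_prod fun k => (hf k).integrable_sq

/-- The function `x ↦ ∏ k, f k (x k)`, in `L²`. -/
noncomputable def tensorFun (f : Fin n → Lp ℝ 2 μ) : Lp ℝ 2 (Measure.pi fun _ : Fin n => μ) :=
  (memLp_two_prod_pi fun k => Lp.memLp (f k)).toLp _

theorem coeFn_tensorFun (f : Fin n → Lp ℝ 2 μ) :
    tensorFun f =ᵐ[Measure.pi fun _ : Fin n => μ] fun x => ∏ k, f k (x k) :=
  MemLp.coeFn_toLp _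

theorem inner_tensorFun (f g : Fin n → Lp ℝ 2 μ) :
    inner ℝ (tensorFun f) (tensorFun g) = ∏ k, inner ℝ (f k) (g k) := by
  simp only [L2.inner_def]
  rw [← integral_fintype_prod_eq_prod (fun k x => inner ℝ (f k x) (g k x))]
  refine integral_congr_ae ?_
  filter_upwards [coeFn_tensorFun f, coeFn_tensorFun g] with x h1 h2
  rw [h1, h2]
  simp only [RCLike.inner_apply, conj_trivial, Finset.prod_mul_distrib]

theorem norm_tensorFun (f : Fin n → Lp ℝ 2 μ) : ‖tensorFun f‖ = ∏ k, ‖f k‖ := by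
  have h : ‖tensorFun f‖ ^ 2 = (∏ k, ‖f k‖) ^ 2 := by
    rw [← real_inner_self_eq_norm_sq, inner_tensorFun, ← Finset.prod_pow]
    simp only [real_inner_self_eq_norm_sq]
  exact (pow_left_inj₀ (norm_nonneg _) (Finset.prod_nonneg fun k _ => norm_nonneg _)
    two_ne_zero).1 h

/-- The tensor product of `n` functions of `L²(μ)`, as a continuous multilinear map. -/
noncomputable def tensor (μ : Measure X) [SigmaFinite μ] (n : ℕ) :
    ContinuousMultilinearMap ℝ (fun _ : Fin n => Lp ℝ 2 μ)
      (Lp ℝ 2 (Measure.pi fun _ : Fin n => μ)) :=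
  MultilinearMap.mkContinuous
    { toFun := tensorFun
      map_update_add' := by
        intro inst m k a b
        -- The multilinearity fields quantify over a decidability instance, which has to be the
        -- canonical one for `Function.update` to match.
        obtain rfl : inst = instDecidableEqFin n := Subsingleton.elim _ _
        refine Lp.ext ?_
        have h := (Measure.quasiMeasurePreserving_eval (fun _ : Fin n => μ) k).ae
          (Lp.coeFn_add a b)
        filter_upwards [coeFn_tensorFun (Function.update m k (a + b)),
          coeFn_tensorFun (Function.update m k a), coeFn_tensorFun (Function.update m k b),
          Lp.coeFn_add (tensorFun (Function.update m k a)) (tensorFun (Function.update m k b)), h]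
          with x h1 h2 h3 h4 h5
        rw [h4, Pi.add_apply, h1, h2, h3, prod_update_eval, prod_update_eval, prod_update_eval,
          h5, Pi.add_apply, add_mul]
      map_update_smul' := by
        intro inst m k c a
        obtain rfl : inst = instDecidableEqFin n := Subsingleton.elim _ _
        refine Lp.ext ?_
        have h := (Measure.quasiMeasurePreserving_eval (fun _ : Fin n => μ) k).ae
          (Lp.coeFn_smul c a)
        filter_upwards [coeFn_tensorFun (Function.update m k (c • a)),
          coeFn_tensorFun (Function.update m k a),
          Lp.coeFn_smul c (tensorFun (Function.update m k a)), h] with x h1 h2 h3 h4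
        rw [h3, Pi.smul_apply, h1, h2, prod_update_eval, prod_update_eval, h4, Pi.smul_apply,
          smul_eq_mul, smul_eq_mul, mul_assoc] }
    1 fun f => by
      rw [one_mul]
      exact (norm_tensorFun f).le

theorem tensor_apply (f : Fin n → Lp ℝ 2 μ) : tensor μ n f = tensorFun f := rfl

/-- The derivative at `a` of the tensor power `a ↦ a ⊗ ⋯ ⊗ a`, in the direction `b`. -/
noncomputable def tensorDeriv (n : ℕ) (a b : Lp ℝ 2 μ) : Lp ℝ 2 (Measure.pi fun _ : Fin n => μ) :=
  ∑ k, tensorFun (Function.update (fun _ => a) k b)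

/-- The tensor power is a continuous multilinear map on the diagonal, so the chain rule replaces any
estimate of remainders in the product of densities. -/
theorem hasDerivAt_tensor {c : ℝ → Lp ℝ 2 μ} {c' : Lp ℝ 2 μ} {t : ℝ} (hc : HasDerivAt c c' t) :
    HasDerivAt (fun s => tensorFun (n := n) fun _ => c s) (tensorDeriv n (c t) c') t := by
  have h := (HasFDerivAt.multilinear_comp (f := tensor μ n)
    (fun _ => hc.hasFDerivAt)).hasDerivAt
  refine h.congr_deriv ?_
  simp only [_root_.sum_apply, ContinuousLinearMap.comp_apply]
  refine Finset.sum_congr rfl fun k _ => ?_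
  simp [tensor_apply, ContinuousMultilinearMap.toContinuousLinearMap]

theorem inner_tensorFun_tensorDeriv {a b : Lp ℝ 2 μ} (hab : inner ℝ a b = 0) :
    inner ℝ (tensorFun (n := n) fun _ => a) (tensorDeriv n a b) = 0 := by
  rw [tensorDeriv, inner_sum]
  refine Finset.sum_eq_zero fun k _ => ?_
  rw [inner_tensorFun]
  exact Finset.prod_eq_zero (Finset.mem_univ k) (by simpa using hab)

/-- Additivity of the information over the sample: in the double sum, a term with distinct positions
has the factor `⟨a, b'⟩ = 0`, and each of the `n` diagonal terms is `⟨b, b'⟩` because `‖a‖ = 1`. -/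
theorem inner_tensorDeriv {a b b' : Lp ℝ 2 μ} (ha : ‖a‖ = 1)
    (hab' : inner ℝ a b' = 0) :
    inner ℝ (tensorDeriv n a b) (tensorDeriv n a b') = n * inner ℝ b b' := by
  simp only [tensorDeriv, sum_inner, inner_sum, inner_tensorFun]
  have h : ∀ k l : Fin n, ∏ j, inner ℝ (Function.update (fun _ => a) k b j)
      (Function.update (fun _ => a) l b' j) = if k = l then inner ℝ b b' else 0 := by
    intro k l
    split_ifs with hkl
    · subst hkl
      rw [← Finset.mul_prod_erase _ _ (Finset.mem_univ k), Function.update_self,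
        Function.update_self, Finset.prod_eq_one, mul_one]
      intro j hj
      rw [Function.update_of_ne (Finset.ne_of_mem_erase hj),
        Function.update_of_ne (Finset.ne_of_mem_erase hj), real_inner_self_eq_norm_sq, ha, one_pow]
    · refine Finset.prod_eq_zero (Finset.mem_univ l) ?_
      rw [Function.update_self, Function.update_of_ne (Ne.symm hkl), hab']
  simp [h]

end Tensor

/-! ### Multiplication operators on `L²` -/

section Mul

variable {Y : Type*} [MeasurableSpace Y] {ν : Measure Y}

/-- Hölder's inequality between `L^∞` and `L²`. This operator writes the mean of `T` as a continuous
quadratic function of the root density, hence differentiable along with it. -/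
theorem exists_mul_clm {T : Y → ℝ} (hT : Measurable T) {C : ℝ} (hC : ∀ y, |T y| ≤ C) :
    ∃ B : Lp ℝ 2 ν →L[ℝ] Lp ℝ 2 ν, ∀ f : Lp ℝ 2 ν, B f =ᵐ[ν] fun y => T y * f y := by
  have hTm : MemLp T ∞ ν := memLp_top_of_bound hT.aestronglyMeasurable C (Eventually.of_forall hC)
  refine ⟨(ContinuousLinearMap.mul ℝ ℝ).holderL ν ∞ 2 2 hTm.toLp, fun f => ?_⟩
  have h := (ContinuousLinearMap.mul ℝ ℝ).coeFn_holder (r := 2) hTm.toLp f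
  filter_upwards [h, hTm.coeFn_toLp] with y h1 h2
  rw [← h2]
  exact h1

theorem inner_eq_integral_mul (f g : Lp ℝ 2 ν) : inner ℝ f g = ∫ y, f y * g y ∂ν := by
  rw [L2.inner_def]
  refine integral_congr_ae (Eventually.of_forall fun y => ?_)
  simp [mul_comm]

end Mul


/-! ### The `n`-sample model -/

/-- It suffices to compare the measures of boxes. The finite total mass of `f` allows real-valued
integrals there, and these factor by Fubini. -/
theorem pi_withDensity {X : Type*} [MeasurableSpace X] {μ : Measure X} [SigmaFinite μ] {n : ℕ}
    {f : X → ℝ≥0} (hf : Measurable f) (h1 : ∫⁻ x, (f x : ℝ≥0∞) ∂μ ≠ ∞) :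
    Measure.pi (fun _ : Fin n => μ.withDensity fun x => (f x : ℝ≥0∞)) =
      (Measure.pi fun _ : Fin n => μ).withDensity fun x => ∏ k, (f (x k) : ℝ≥0∞) := by
  have hfin : IsFiniteMeasure (μ.withDensity fun x => (f x : ℝ≥0∞)) :=
    isFiniteMeasure_withDensity h1
  have hfi : Integrable (fun x => (f x : ℝ)) μ := by
    refine ⟨hf.coe_nnreal_real.aestronglyMeasurable, ?_⟩
    rw [hasFiniteIntegral_iff_enorm]
    refine lt_of_eq_of_lt (lintegral_congr fun x => ?_) (lt_top_iff_ne_top.2 h1)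
    rw [Real.enorm_of_nonneg (NNReal.coe_nonneg _), ENNReal.ofReal_coe_nnreal]
  refine Measure.pi_eq fun s hs => ?_
  have hsi : ∀ k, Integrable ((s k).indicator fun x => (f x : ℝ)) μ := fun k =>
    hfi.indicator (hs k)
  have hnn : ∀ k x, 0 ≤ (s k).indicator (fun x => (f x : ℝ)) x := fun k x =>
    Set.indicator_nonneg (fun x _ => (f x).2) x
  rw [withDensity_apply _ (MeasurableSet.univ_pi hs),
    ← lintegral_indicator (MeasurableSet.univ_pi hs)]
  have h2 : ∀ x : Fin n → X, (Set.univ.pi s).indicator (fun x => ∏ k, (f (x k) : ℝ≥0∞)) x =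
      ENNReal.ofReal (∏ k, (s k).indicator (fun x => (f x : ℝ)) (x k)) := by
    intro x
    rw [ENNReal.ofReal_prod_of_nonneg fun k _ => hnn k _]
    by_cases hx : x ∈ Set.univ.pi s
    · rw [Set.indicator_of_mem hx]
      refine Finset.prod_congr rfl fun k _ => ?_
      rw [Set.indicator_of_mem (hx k (Set.mem_univ k)), ENNReal.ofReal_coe_nnreal]
    · rw [Set.indicator_of_notMem hx]
      simp only [Set.mem_pi, Set.mem_univ, true_implies, not_forall] at hx
      obtain ⟨k, hk⟩ := hx
      refine (Finset.prod_eq_zero (Finset.mem_univ k) ?_).symm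
      rw [Set.indicator_of_notMem hk, ENNReal.ofReal_zero]
  rw [lintegral_congr h2, ← ofReal_integral_eq_lintegral_ofReal (Integrable.fintype_prod hsi)
    (Eventually.of_forall fun x => Finset.prod_nonneg fun k _ => hnn k _),
    integral_fintype_prod_eq_prod (fun k x => (s k).indicator (fun x => (f x : ℝ)) x),
    ENNReal.ofReal_prod_of_nonneg fun k _ => integral_nonneg (hnn k)]
  refine Finset.prod_congr rfl fun k _ => ?_
  rw [withDensity_apply _ (hs k), ofReal_integral_eq_lintegral_ofReal (hsi k)
    (Eventually.of_forall (hnn k)), ← lintegral_indicator (hs k)]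
  refine lintegral_congr fun x => ?_
  by_cases hx : x ∈ s k
  · rw [Set.indicator_of_mem hx, Set.indicator_of_mem hx, ENNReal.ofReal_coe_nnreal]
  · rw [Set.indicator_of_notMem hx, Set.indicator_of_notMem hx, ENNReal.ofReal_zero]

namespace DominatedModel

variable {p : ℕ} {Θ : Set (E p)} {X : Type*} [MeasurableSpace X] {μ : Measure X}

theorem measurable_density_of_mem (M : DominatedModel Θ μ) {θ : E p} (hθ : θ ∈ Θ) :
    Measurable (M.density θ) :=
  M.measurable_density.comp (measurable_prodMk_left (x := (⟨θ, hθ⟩ : Θ)))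

/-- A jointly measurable density on the whole space, so that shifted parameters can be inserted
without checking that they stay in `Θ`. -/
theorem exists_measurable_density (M : DominatedModel Θ μ) (hΘ : MeasurableSet Θ) :
    ∃ f : E p × X → ℝ≥0, Measurable f ∧ ∀ θ ∈ Θ, ∀ x, f (θ, x) = M.density θ x := by
  have hemb : MeasurableEmbedding (Prod.map ((↑) : Θ → E p) (id : X → X)) :=
    (MeasurableEmbedding.subtype_coe hΘ).prodMap MeasurableEmbedding.id
  obtain ⟨f, hf, hfe⟩ := hemb.exists_measurable_extend M.measurable_density fun _ => ⟨0⟩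
  exact ⟨f, hf, fun θ hθ x => congr_fun hfe (⟨θ, hθ⟩, x)⟩

theorem memLp_root (M : DominatedModel Θ μ) {θ : E p} (hθ : θ ∈ Θ) : MemLp (M.root θ) 2 μ := by
  have hm := M.measurable_density_of_mem hθ
  have hmr : Measurable (M.root θ) := hm.coe_nnreal_real.sqrt
  rw [memLp_two_iff_integrable_sq hmr.aestronglyMeasurable]
  simp only [root, Real.sq_sqrt (NNReal.coe_nonneg _)]
  refine ⟨hm.coe_nnreal_real.aestronglyMeasurable, ?_⟩
  rw [hasFiniteIntegral_iff_enorm]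
  refine lt_of_eq_of_lt (lintegral_congr fun x => ?_)
    ((M.lintegral_density θ hθ).trans_lt ENNReal.one_lt_top)
  rw [Real.enorm_of_nonneg (NNReal.coe_nonneg _), ENNReal.ofReal_coe_nnreal]

open Classical in
/-- The square root of the density, as an element of `L²`. -/
noncomputable def rootLp (M : DominatedModel Θ μ) (θ : E p) : Lp ℝ 2 μ :=
  if h : MemLp (M.root θ) 2 μ then h.toLp else 0

theorem coeFn_rootLp (M : DominatedModel Θ μ) {θ : E p} (hθ : θ ∈ Θ) :
    M.rootLp θ =ᵐ[μ] M.root θ := by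
  rw [rootLp, dif_pos (M.memLp_root hθ)]
  exact MemLp.coeFn_toLp _

theorem norm_rootLp (M : DominatedModel Θ μ) {θ : E p} (hθ : θ ∈ Θ) : ‖M.rootLp θ‖ = 1 := by
  have h : ‖M.rootLp θ‖ ^ 2 = 1 := by
    rw [← real_inner_self_eq_norm_sq, inner_eq_integral_mul]
    have h1 : ∫ x, M.rootLp θ x * M.rootLp θ x ∂μ = ∫ x, (M.density θ x : ℝ) ∂μ := by
      refine integral_congr_ae ?_
      filter_upwards [M.coeFn_rootLp hθ] with x hx
      rw [hx, root, Real.mul_self_sqrt (NNReal.coe_nonneg _)]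
    rw [h1, integral_eq_lintegral_of_nonneg_ae (Eventually.of_forall fun x => NNReal.coe_nonneg _)
      (M.measurable_density_of_mem hθ).coe_nnreal_real.aestronglyMeasurable]
    simp only [ENNReal.ofReal_coe_nnreal, M.lintegral_density θ hθ, ENNReal.toReal_one]
  exact (pow_eq_one_iff_of_nonneg (norm_nonneg _) two_ne_zero).1 h

theorem eventually_add_smul_mem {Θ : Set (E p)} (hΘ : IsOpen Θ) {θ : E p} (hθ : θ ∈ Θ) (v : E p) :
    ∀ᶠ t : ℝ in 𝓝 0, θ + t • v ∈ Θ := by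
  have h : Tendsto (fun t : ℝ => θ + t • v) (𝓝 0) (𝓝 θ) := by
    have : Continuous fun t : ℝ => θ + t • v := by fun_prop
    simpa using this.tendsto 0
  exact h.eventually (hΘ.mem_nhds hθ)

theorem HasL2Partials.hasDerivAt_rootLp {M : DominatedModel Θ μ} (hΘ : IsOpen Θ) {θ : E p}
    (hθ : θ ∈ Θ) {g : Fin p → X → ℝ} (hg : M.HasL2Partials θ g) (i : Fin p) :
    HasDerivAt (fun t : ℝ => M.rootLp (θ + t • e i)) (hg i).1.toLp 0 := by
  rw [hasDerivAt_iff_isLittleO]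
  simp only [sub_zero, zero_smul, add_zero]
  refine IsLittleO.of_norm_left ((hg i).2.congr' ?_ EventuallyEq.rfl)
  filter_upwards [eventually_add_smul_mem hΘ hθ (e i)] with t ht
  rw [Lp.norm_def]
  congr 1
  refine eLpNorm_congr_ae ?_
  filter_upwards [M.coeFn_rootLp hθ, M.coeFn_rootLp ht, (hg i).1.coeFn_toLp,
    Lp.coeFn_sub (M.rootLp (θ + t • e i) - M.rootLp θ) (t • (hg i).1.toLp),
    Lp.coeFn_sub (M.rootLp (θ + t • e i)) (M.rootLp θ),
    Lp.coeFn_smul t (hg i).1.toLp] with x h1 h2 h3 h4 h5 h6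
  rw [h4, Pi.sub_apply, h5, Pi.sub_apply, h6, Pi.smul_apply, h1, h2, h3, smul_eq_mul]

/-- The score is centred: differentiate `‖ξ_θ‖² = 1`. -/
theorem inner_rootLp_deriv {M : DominatedModel Θ μ} (hΘ : IsOpen Θ) {θ : E p} (hθ : θ ∈ Θ)
    {i : Fin p} {d : Lp ℝ 2 μ} (hd : HasDerivAt (fun t : ℝ => M.rootLp (θ + t • e i)) d 0) :
    inner ℝ (M.rootLp θ) d = 0 := by
  have h1 := hd.inner ℝ hd
  have h2 : HasDerivAt (fun t : ℝ => inner ℝ (M.rootLp (θ + t • e i)) (M.rootLp (θ + t • e i)))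
      0 0 := by
    refine (hasDerivAt_const (0 : ℝ) (1 : ℝ)).congr_of_eventuallyEq ?_
    filter_upwards [eventually_add_smul_mem hΘ hθ (e i)] with t ht
    rw [real_inner_self_eq_norm_sq, M.norm_rootLp ht, one_pow]
  have h3 := h1.unique h2
  simp only [zero_smul, add_zero, real_inner_comm] at h3
  rw [real_inner_comm] at h3
  linarith

theorem fisherInfo_eq_inner {g : Fin p → X → ℝ} (hg : ∀ i, MemLp (g i) 2 μ) (i j : Fin p) :
    fisherInfo μ g i j = 4 * inner ℝ (hg i).toLp (hg j).toLp := by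
  rw [inner_eq_integral_mul, fisherInfo, Matrix.of_apply]
  congr 1
  refine integral_congr_ae ?_
  filter_upwards [(hg i).coeFn_toLp, (hg j).coeFn_toLp] with x h1 h2
  rw [h1, h2]

theorem isProbabilityMeasure_sampleLaw (M : DominatedModel Θ μ) (n : ℕ) {θ : E p} (hθ : θ ∈ Θ) :
    IsProbabilityMeasure (M.sampleLaw n θ) := by
  have : IsProbabilityMeasure (M.law θ) :=
    ⟨by rw [law, withDensity_apply _ MeasurableSet.univ, Measure.restrict_univ,
      M.lintegral_density θ hθ]⟩
  unfold sampleLaw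
  infer_instance

theorem measurable_prod_density (M : DominatedModel Θ μ) (n : ℕ) {θ : E p} (hθ : θ ∈ Θ) :
    Measurable fun x : Fin n → X => ∏ k, (M.density θ (x k) : ℝ≥0∞) :=
  Finset.measurable_fun_prod _ fun k _ =>
    ((M.measurable_density_of_mem hθ).comp (measurable_pi_apply k)).coe_nnreal_ennreal

variable [SigmaFinite μ]

/-- The square root of the density of an `n`-sample, as an element of `L²`. -/
noncomputable def sampleRoot (M : DominatedModel Θ μ) (n : ℕ) (θ : E p) :
    Lp ℝ 2 (Measure.pi fun _ : Fin n => μ) :=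
  tensorFun fun _ => M.rootLp θ

theorem sampleLaw_eq (M : DominatedModel Θ μ) (n : ℕ) {θ : E p} (hθ : θ ∈ Θ) :
    M.sampleLaw n θ = (Measure.pi fun _ : Fin n => μ).withDensity
      fun x => ∏ k, (M.density θ (x k) : ℝ≥0∞) :=
  pi_withDensity (M.measurable_density_of_mem hθ)
    (by rw [M.lintegral_density θ hθ]; exact ENNReal.one_ne_top)

theorem integral_sampleLaw (M : DominatedModel Θ μ) (n : ℕ) {θ : E p} (hθ : θ ∈ Θ)
    (h : (Fin n → X) → ℝ) : ∫ x, h x ∂(M.sampleLaw n θ) =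
      ∫ x, h x * ∏ k, (M.density θ (x k) : ℝ) ∂(Measure.pi fun _ : Fin n => μ) := by
  rw [M.sampleLaw_eq n hθ, integral_withDensity_eq_integral_toReal_smul
    (M.measurable_prod_density n hθ) (Eventually.of_forall fun x => by
      exact ENNReal.prod_lt_top fun k _ => ENNReal.coe_lt_top)]
  refine integral_congr_ae (Eventually.of_forall fun x => ?_)
  simp only [ENNReal.toReal_prod, ENNReal.coe_toReal, smul_eq_mul, mul_comm]

theorem integral_sampleLaw_eq_sampleRoot (M : DominatedModel Θ μ) (n : ℕ) {θ : E p} (hθ : θ ∈ Θ)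
    (h : (Fin n → X) → ℝ) : ∫ x, h x ∂(M.sampleLaw n θ) =
      ∫ x, h x * M.sampleRoot n θ x ^ 2 ∂(Measure.pi fun _ : Fin n => μ) := by
  rw [M.integral_sampleLaw n hθ]
  refine integral_congr_ae ?_
  have h1 : ∀ᵐ x ∂(Measure.pi fun _ : Fin n => μ), ∀ k, M.rootLp θ (x k) = M.root θ (x k) :=
    ae_all_iff.2 fun k =>
      (Measure.quasiMeasurePreserving_eval (fun _ : Fin n => μ) k).ae (M.coeFn_rootLp hθ)
  filter_upwards [h1, coeFn_tensorFun (fun _ : Fin n => M.rootLp θ)] with x h2 h3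
  rw [sampleRoot, h3, ← Finset.prod_pow]
  congr 1
  refine Finset.prod_congr rfl fun k _ => ?_
  rw [h2 k, root, Real.sq_sqrt (NNReal.coe_nonneg _)]

/-- The means of a bounded statistic have partial derivatives, which satisfy the inequality of
Cramér and Rao. -/
theorem HasL2Partials.cramerRao {M : DominatedModel Θ μ} (hΘ : IsOpen Θ) {θ : E p} (hθ : θ ∈ Θ)
    {g : Fin p → X → ℝ} (hg : M.HasL2Partials θ g) (n : ℕ) {T : (Fin n → X) → ℝ}
    (hT : Measurable T) {C : ℝ} (hC : ∀ x, |T x| ≤ C) :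
    (∀ i, LineDifferentiableAt ℝ (fun θ' => ∫ x, T x ∂(M.sampleLaw n θ')) θ (e i)) ∧
      ∀ (w : Fin p → ℝ) (β b : ℝ),
        (∑ i, w i * lineDeriv ℝ (fun θ' => ∫ x, T x ∂(M.sampleLaw n θ')) θ (e i) +
          β * ((∫ x, T x ∂(M.sampleLaw n θ)) - b)) ^ 2 ≤
        (∫ x, (T x - b) ^ 2 ∂(M.sampleLaw n θ)) *
          (w ⬝ᵥ ((n : ℝ) • fisherInfo μ g) *ᵥ w + β ^ 2) := by
  set ν := Measure.pi fun _ : Fin n => μ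
  obtain ⟨B, hB⟩ := exists_mul_clm (ν := ν) hT hC
  have hBinner : ∀ f f' : Lp ℝ 2 ν, inner ℝ (B f) f' = ∫ x, T x * (f x * f' x) ∂ν := by
    intro f f'
    rw [inner_eq_integral_mul]
    refine integral_congr_ae ?_
    filter_upwards [hB f] with x hx
    rw [hx, mul_assoc]
  have hBsymm : ∀ f f' : Lp ℝ 2 ν, inner ℝ (B f) f' = inner ℝ (B f') f := by
    intro f f'
    rw [hBinner, hBinner]
    simp only [mul_comm]
  -- The mean becomes a quadratic form in the root density. Symmetry of `B` yields the factor `2` in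
  -- its derivative.
  have hmean : ∀ θ' ∈ Θ, ∫ x, T x ∂(M.sampleLaw n θ') =
      inner ℝ (B (M.sampleRoot n θ')) (M.sampleRoot n θ') := by
    intro θ' hθ'
    rw [hBinner, M.integral_sampleLaw_eq_sampleRoot n hθ']
    simp only [sq, ν]
  set Ξ := M.sampleRoot n θ with hΞ
  set s : Fin p → Lp ℝ 2 μ := fun i => (hg i).1.toLp with hs
  have hsd : ∀ i, HasDerivAt (fun t : ℝ => M.rootLp (θ + t • e i)) (s i) 0 := fun i =>
    hg.hasDerivAt_rootLp hΘ hθ i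
  have hs0 : ∀ i, inner ℝ (M.rootLp θ) (s i) = 0 := fun i => inner_rootLp_deriv hΘ hθ (hsd i)
  set D : Fin p → Lp ℝ 2 ν := fun i => tensorDeriv n (M.rootLp θ) (s i) with hD
  have hΞd : ∀ i, HasDerivAt (fun t : ℝ => M.sampleRoot n (θ + t • e i)) (D i) 0 := by
    intro i
    have := hasDerivAt_tensor (n := n) (hsd i)
    simpa only [zero_smul, add_zero, sampleRoot] using! this
  have hDD : ∀ i j, inner ℝ (D i) (D j) = n * inner ℝ (s i) (s j) := fun i j =>
    inner_tensorDeriv (M.norm_rootLp hθ) (hs0 j)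
  have hΞD : ∀ i, inner ℝ Ξ (D i) = 0 := fun i => inner_tensorFun_tensorDeriv (hs0 i)
  have hΞ1 : inner ℝ Ξ Ξ = 1 := by
    rw [hΞ, sampleRoot, inner_tensorFun]
    simp [M.norm_rootLp hθ]
  have hderiv : ∀ i, HasLineDerivAt ℝ (fun θ' => ∫ x, T x ∂(M.sampleLaw n θ'))
      (2 * inner ℝ (B Ξ) (D i)) θ (e i) := by
    intro i
    have h1 := (B.hasFDerivAt.comp_hasDerivAt (0 : ℝ) (hΞd i)).inner ℝ (hΞd i)
    have h2 : HasDerivAt (fun t : ℝ => ∫ x, T x ∂(M.sampleLaw n (θ + t • e i)))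
        (inner ℝ (B (M.sampleRoot n (θ + (0 : ℝ) • e i))) (D i) +
          inner ℝ (B (D i)) (M.sampleRoot n (θ + (0 : ℝ) • e i))) 0 := by
      refine h1.congr_of_eventuallyEq ?_
      filter_upwards [eventually_add_smul_mem hΘ hθ (e i)] with t ht
      exact hmean _ ht
    refine HasDerivAt.congr_deriv h2 ?_
    rw [hBsymm (D i)]
    simp only [zero_smul, add_zero]
    ring
  refine ⟨fun i => (hderiv i).lineDifferentiableAt, fun w β b => ?_⟩
  simp only [fun i => (hderiv i).lineDeriv, hmean θ hθ]
  -- Cauchy–Schwarz will be applied to `R = (T - b) Ξ`, whose squared norm is the risk, and to `W`.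
  -- As `Ξ` is a unit vector orthogonal to each `D i`, `‖W‖²` splits into the information form (`4 n
  -- ⟨s i, s j⟩` is `n` times the Fisher information) and `β²`, and the `b`-terms of `⟨R, W⟩` reduce
  -- to `-β b`.
  set R := B Ξ - b • Ξ with hR
  set W := (2 : ℝ) • (∑ i, w i • D i) + β • Ξ with hW
  have hRn : ∫ x, (T x - b) ^ 2 ∂(M.sampleLaw n θ) = ‖R‖ ^ 2 := by
    rw [M.integral_sampleLaw_eq_sampleRoot n hθ, ← real_inner_self_eq_norm_sq,
      inner_eq_integral_mul]
    refine integral_congr_ae ?_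
    filter_upwards [hB Ξ, Lp.coeFn_sub (B Ξ) (b • Ξ), Lp.coeFn_smul b Ξ] with x h1 h2 h3
    rw [hR, h2, Pi.sub_apply, h1, h3, Pi.smul_apply, smul_eq_mul]
    ring
  have hDw0 : inner ℝ Ξ (∑ i, w i • D i) = 0 := by
    simp [inner_sum, inner_smul_right, hΞD]
  have hRW : inner ℝ R W = ∑ i, w i * (2 * inner ℝ (B Ξ) (D i)) +
      β * (inner ℝ (B Ξ) Ξ - b) := by
    simp only [hR, hW, inner_sub_left, inner_add_right, real_inner_smul_left,
      real_inner_smul_right, hDw0, hΞ1]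
    have : inner ℝ (B Ξ) (∑ i, w i • D i) * 2 = ∑ i, w i * (2 * inner ℝ (B Ξ) (D i)) := by
      rw [inner_sum, Finset.sum_mul]
      exact Finset.sum_congr rfl fun i _ => by rw [real_inner_smul_right]; ring
    rw [← this]
    ring
  have hWn : ‖W‖ ^ 2 = w ⬝ᵥ ((n : ℝ) • fisherInfo μ g) *ᵥ w + β ^ 2 := by
    have h1 : inner ℝ (∑ i, w i • D i) Ξ = 0 := by rw [real_inner_comm, hDw0]
    rw [← real_inner_self_eq_norm_sq, hW]
    simp only [inner_add_left, inner_add_right, real_inner_smul_left, real_inner_smul_right, hDw0,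
      h1, hΞ1]
    have h2 : inner ℝ (∑ i, w i • D i) (∑ i, w i • D i) * 4 =
        w ⬝ᵥ ((n : ℝ) • fisherInfo μ g) *ᵥ w := by
      simp only [sum_inner, inner_sum, real_inner_smul_left, real_inner_smul_right, hDD,
        dotProduct, Matrix.mulVec, Matrix.smul_apply, fisherInfo_eq_inner fun i => (hg i).1,
        Finset.mul_sum, Finset.sum_mul, smul_eq_mul]
      refine Finset.sum_congr rfl fun i _ => Finset.sum_congr rfl fun j _ => ?_
      rw [real_inner_comm]
      ring
    linarith
  rw [hRn, ← hRW, ← hWn, ← mul_pow, ← sq_abs]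
  gcongr
  exact abs_real_inner_le_norm R W

end DominatedModel


/-! ### Measurability in the parameter -/

namespace DominatedModel

variable {p : ℕ} {Θ : Set (E p)} {X : Type*} [MeasurableSpace X] {μ : Measure X} [SigmaFinite μ]

theorem exists_measurable_mean (M : DominatedModel Θ μ) (hΘ : MeasurableSet Θ) (n : ℕ)
    {T : (Fin n → X) → ℝ} (hT : Measurable T) :
    ∃ F : E p → ℝ, Measurable F ∧ ∀ θ ∈ Θ, F θ = ∫ x, T x ∂(M.sampleLaw n θ) := by
  obtain ⟨f, hf, hfe⟩ := M.exists_measurable_density hΘ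
  refine ⟨fun θ => ∫ x, T x * ∏ k, (f (θ, x k) : ℝ) ∂(Measure.pi fun _ : Fin n => μ), ?_, ?_⟩
  · have hm : Measurable fun z : E p × (Fin n → X) => T z.2 * ∏ k, (f (z.1, z.2 k) : ℝ) := by
      refine (hT.comp measurable_snd).mul (Finset.measurable_fun_prod _ fun k _ => ?_)
      exact (hf.comp (measurable_fst.prodMk
        ((measurable_pi_apply k).comp measurable_snd))).coe_nnreal_real
    exact hm.stronglyMeasurable.integral_prod_right'.measurable
  · intro θ hθ
    rw [M.integral_sampleLaw n hθ]
    simp only [hfe θ hθ]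

/-- The derivatives `dξ θ` are chosen separately for each `θ`, without joint measurability. Their
inner products are nevertheless limits of inner products of difference quotients of root densities,
which are measurable in `θ` by Fubini. -/
theorem exists_measurable_fisherInfo (M : DominatedModel Θ μ) (hΘ : IsOpen Θ) {N : Set (E p)}
    (hN : MeasurableSet N) (hNΘ : N ⊆ Θ) {dξ : E p → Fin p → X → ℝ}
    (hdξ : ∀ θ ∈ N, M.HasL2Partials θ (dξ θ)) (i j : Fin p) :
    ∃ F : E p → ℝ, Measurable F ∧ ∀ θ ∈ N, F θ = fisherInfo μ (dξ θ) i j := by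
  obtain ⟨f, hf, hfe⟩ := M.exists_measurable_density hΘ.measurableSet
  set r : E p → X → ℝ := fun θ x => √(f (θ, x) : ℝ) with hr
  have hrr : ∀ θ ∈ Θ, r θ =ᵐ[μ] M.rootLp θ := by
    intro θ hθ
    filter_upwards [M.coeFn_rootLp hθ] with x hx
    simp only [hx, hr, root, hfe θ hθ]
  have hrm : Measurable (Function.uncurry r) := hf.coe_nnreal_real.sqrt
  set τ : ℕ → ℝ := fun k => 1 / ((k : ℝ) + 1) with hτdef
  have hτ0 : Tendsto τ atTop (𝓝 0) := tendsto_one_div_add_atTop_nhds_zero_nat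
  have hτ : Tendsto τ atTop (𝓝[≠] 0) := by
    rw [tendsto_nhdsWithin_iff]
    exact ⟨hτ0, Eventually.of_forall fun k => (Nat.one_div_pos_of_nat (α := ℝ)).ne'⟩
  set G : ℕ → E p → ℝ := fun k θ => 4 * ((τ k)⁻¹ * ((τ k)⁻¹ *
    ∫ x, (r (θ + τ k • e i) x - r θ x) * (r (θ + τ k • e j) x - r θ x) ∂μ)) with hG
  have hGm : ∀ k, Measurable (G k) := by
    intro k
    have hm : ∀ i : Fin p, Measurable fun z : E p × X => r (z.1 + τ k • e i) z.2 - r z.1 z.2 := by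
      intro i
      refine Measurable.sub ?_ hrm
      exact hrm.comp ((measurable_fst.add_const (τ k • e i : E p)).prodMk measurable_snd)
    exact ((((hm i).mul (hm j)).stronglyMeasurable.integral_prod_right'.measurable.const_mul
      _).const_mul _).const_mul _
  refine ⟨N.indicator fun θ => fisherInfo μ (dξ θ) i j, ?_, fun θ hθ => Set.indicator_of_mem hθ _⟩
  refine measurable_of_tendsto_metrizable (fun k => (hGm k).indicator hN) ?_
  rw [tendsto_pi_nhds]
  intro θ
  by_cases hθ : θ ∈ N
  · simp only [Set.indicator_of_mem hθ]
    have hθΘ := hNΘ hθ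
    have hlim : ∀ i, Tendsto (fun k => (τ k)⁻¹ • (M.rootLp (θ + τ k • e i) - M.rootLp θ)) atTop
        (𝓝 (hdξ θ hθ i).1.toLp) := by
      intro i
      have := (hasDerivAt_iff_tendsto_slope_zero.1
        ((hdξ θ hθ).hasDerivAt_rootLp hΘ hθΘ i)).comp hτ
      simpa [Function.comp_def] using this
    have h1 := ((hlim i).inner (𝕜 := ℝ) (hlim j)).const_mul 4
    rw [← fisherInfo_eq_inner fun i => (hdξ θ hθ i).1] at h1
    refine h1.congr' ?_
    filter_upwards [hτ0.eventually (eventually_add_smul_mem hΘ hθΘ (e i)),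
      hτ0.eventually (eventually_add_smul_mem hΘ hθΘ (e j))] with k hi hj
    rw [real_inner_smul_left, real_inner_smul_right, inner_eq_integral_mul, hG]
    congr 3
    refine integral_congr_ae ?_
    filter_upwards [hrr _ hi, hrr _ hj, hrr _ hθΘ,
      Lp.coeFn_sub (M.rootLp (θ + τ k • e i)) (M.rootLp θ),
      Lp.coeFn_sub (M.rootLp (θ + τ k • e j)) (M.rootLp θ)] with x h1 h2 h3 h4 h5
    rw [h4, h5, Pi.sub_apply, Pi.sub_apply, h1, h2, h3]
  · simp only [Set.indicator_of_notMem hθ]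
    exact tendsto_const_nhds

end DominatedModel

/-! ### Affine changes of the parameter -/

section Affine

variable {p : ℕ}

theorem _root_.AbsolutelyContinuousOnInterval.comp_affine {f : ℝ → ℝ} {x κ a b : ℝ} (hκ : 0 < κ)
    (hab : a ≤ b) (hf : AbsolutelyContinuousOnInterval f (x + κ * a) (x + κ * b)) :
    AbsolutelyContinuousOnInterval (fun t => f (x + κ * t)) a b := by
  rw [absolutelyContinuousOnInterval_iff] at hf ⊢
  intro ε hε
  obtain ⟨δ, hδ, hd⟩ := hf ε hε
  refine ⟨δ / κ, by positivity, fun I hI hlt => ?_⟩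
  refine hd (I.1, fun i => (x + κ * (I.2 i).1, x + κ * (I.2 i).2)) ⟨?_, ?_⟩ ?_
  · intro i hi
    have h := hI.1 i hi
    rw [Set.uIcc_of_le hab] at h
    rw [Set.uIcc_of_le (by gcongr)]
    exact ⟨⟨by have := h.1.1; simp only; gcongr, by have := h.1.2; simp only; gcongr⟩,
      ⟨by have := h.2.1; simp only; gcongr, by have := h.2.2; simp only; gcongr⟩⟩
  · intro i hi j hj hij
    have h := hI.2 hi hj hij
    rw [Function.onFun, Set.disjoint_left] at h ⊢
    have key : ∀ (k : ℕ) (y : ℝ), y ∈ Set.uIoc (x + κ * (I.2 k).1) (x + κ * (I.2 k).2) →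
        (y - x) / κ ∈ Set.uIoc (I.2 k).1 (I.2 k).2 := by
      intro k y hy
      rw [Set.mem_uIoc] at hy ⊢
      refine hy.imp ?_ ?_ <;>
      · rintro ⟨h1, h2⟩
        refine ⟨?_, ?_⟩
        · rw [lt_div_iff₀ hκ]; linarith
        · rw [div_le_iff₀ hκ]; linarith
    intro y hy1 hy2
    exact h (key i y hy1) (key j y hy2)
  · have h1 : ∀ i, dist (x + κ * (I.2 i).1) (x + κ * (I.2 i).2) =
        κ * dist (I.2 i).1 (I.2 i).2 := by
      intro i
      rw [dist_add_left, Real.dist_eq, Real.dist_eq, ← mul_sub, abs_mul, abs_of_pos hκ]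
    simp only [h1, ← Finset.mul_sum]
    rw [lt_div_iff₀ hκ] at hlt
    linarith

theorem quasiMeasurePreserving_affine {F : Type*} [NormedAddCommGroup F] [NormedSpace ℝ F]
    [MeasurableSpace F] [BorelSpace F] [FiniteDimensional ℝ F] (ν : Measure F) [ν.IsAddHaarMeasure]
    (x : F) {κ : ℝ} (hκ : κ ≠ 0) :
    Measure.QuasiMeasurePreserving (fun h : F => x + κ • h) ν ν :=
  (measurePreserving_add_left ν x).quasiMeasurePreserving.comp
    (Measure.quasiMeasurePreserving_smul ν hκ)

theorem affine_glue (x : E p) (κ : ℝ) (i : Fin p) (t : ℝ) (v : {j : Fin p // j ≠ i} → ℝ) :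
    x + κ • glue i t v = glue i (x i + κ * t) ((fun j : {j : Fin p // j ≠ i} => x j) + κ • v) := by
  ext j
  by_cases h : j = i
  · subst h; simp [glue]
  · simp [glue, h]

theorem IsNice.comp_affine {N : Set (E p)} {φ : E p → ℝ} (hφ : IsNice N φ) (x : E p) {κ : ℝ}
    (hκ : 0 < κ) : IsNice ((fun h => x + κ • h) ⁻¹' N) fun h => φ (x + κ • h) := by
  intro i
  have h1 := (quasiMeasurePreserving_affine
    (volume : Measure ({j : Fin p // j ≠ i} → ℝ)) (fun j : {j : Fin p // j ≠ i} => x j) hκ.ne').ae (hφ i)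
  filter_upwards [h1] with v hv a b hab hmem
  simp only [affine_glue]
  refine AbsolutelyContinuousOnInterval.comp_affine
    (f := fun t => φ (glue i t ((fun j : {j : Fin p // j ≠ i} => x j) + κ • v))) hκ hab
    (hv _ _ (by gcongr) fun t ht => ?_)
  have h2 := hmem ((t - x i) / κ) ⟨by rw [le_div_iff₀ hκ]; linarith [ht.1],
    by rw [div_le_iff₀ hκ]; linarith [ht.2]⟩
  rw [Set.mem_preimage, affine_glue, mul_div_cancel₀ _ hκ.ne', add_sub_cancel] at h2
  exact h2

theorem lineDeriv_comp_affine (f : E p → ℝ) (x h v : E p) (κ : ℝ) :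
    lineDeriv ℝ (fun h => f (x + κ • h)) h v = κ * lineDeriv ℝ f (x + κ • h) v := by
  have h1 : (fun t : ℝ => f (x + κ • (h + t • v))) =
      fun t => (fun s : ℝ => f (x + κ • h + s • v)) (κ * t) := by
    funext t
    simp only [smul_add, smul_smul, add_assoc]
  rw [lineDeriv, h1, deriv_comp_mul_left κ (fun s : ℝ => f (x + κ • h + s • v)) 0]
  simp [lineDeriv]

theorem _root_.LineDifferentiableAt.comp_affine {f : E p → ℝ} {x h v : E p} {κ : ℝ}
    (hf : LineDifferentiableAt ℝ f (x + κ • h) v) :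
    LineDifferentiableAt ℝ (fun h => f (x + κ • h)) h v := by
  have h1 : (fun t : ℝ => f (x + κ • (h + t • v))) =
      fun t => (fun s : ℝ => f (x + κ • h + s • v)) (κ * t) := by
    funext t
    simp only [smul_add, smul_smul, add_assoc]
  rw [LineDifferentiableAt, h1]
  have h2 : DifferentiableAt ℝ (fun s : ℝ => f (x + κ • h + s • v)) (κ * 0) := by
    simpa [LineDifferentiableAt] using hf
  exact h2.comp (0 : ℝ) (differentiableAt_id.const_mul κ)

end Affine


/-! ### Linear combinations of the components of the target -/

section LinComb

variable {p s : ℕ} {N : Set (E p)} {ψ : E p → E s}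

theorem IsNice.linComb (hψ : ∀ j : Fin s, IsNice N fun θ => ψ θ j) (a : Fin s → ℝ) :
    IsNice N fun θ => ∑ j, a j * ψ θ j := by
  intro i
  filter_upwards [ae_all_iff.2 fun j => hψ j i] with v hv x y hxy hmem
  have h : ∀ t : Finset (Fin s), AbsolutelyContinuousOnInterval
      (fun r => ∑ j ∈ t, a j * ψ (glue i r v) j) x y := by
    intro t
    induction t using Finset.induction_on with
    | empty =>
      simp only [Finset.sum_empty]
      exact (LipschitzWith.const (0 : ℝ)).lipschitzOnWith.absolutelyContinuousOnInterval
    | insert j t hj ih =>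
      simp only [Finset.sum_insert hj]
      exact ((hv j x y hxy hmem).const_mul (a j)).fun_add ih
  exact h Finset.univ

theorem aemeasurable_component (hψm : AEMeasurable ψ (volume.restrict N)) (j : Fin s) :
    AEMeasurable (fun θ => ψ θ j) (volume.restrict N) :=
  (EuclideanSpace.proj (𝕜 := ℝ) j).continuous.measurable.comp_aemeasurable hψm

theorem ae_hasPartials (hN : IsOpen N) (hψm : AEMeasurable ψ (volume.restrict N))
    (hψ : ∀ j : Fin s, IsNice N fun θ => ψ θ j) : ∀ᵐ θ ∂(volume.restrict N), HasPartials ψ θ := by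
  rw [ae_restrict_iff' hN.measurableSet]
  have h := fun i j => ((hψ j).ae_lineDifferentiableAt_and_aemeasurable hN
    (aemeasurable_component hψm j) i).1
  filter_upwards [ae_all_iff.2 fun i => ae_all_iff.2 (h i)] with θ hθ hθN i j using hθ i j hθN

theorem aemeasurable_grad (hN : IsOpen N) (hψm : AEMeasurable ψ (volume.restrict N))
    (hψ : ∀ j : Fin s, IsNice N fun θ => ψ θ j) (i : Fin p) (j : Fin s) :
    AEMeasurable (fun θ => grad ψ θ i j) (volume.restrict N) :=
  ((hψ j).ae_lineDifferentiableAt_and_aemeasurable hN (aemeasurable_component hψm j) i).2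

theorem HasPartials.lineDeriv_linComb {θ : E p} (h : HasPartials ψ θ) (a : Fin s → ℝ)
    (i : Fin p) :
    lineDeriv ℝ (fun θ => ∑ j, a j * ψ θ j) θ (e i) = ∑ j, grad ψ θ i j * a j := by
  refine HasLineDerivAt.lineDeriv ?_
  refine (HasDerivAt.fun_sum fun j _ => ((h i j).hasLineDerivAt.const_mul (a j))).congr_deriv ?_
  exact Finset.sum_congr rfl fun j _ => by simp [grad, mul_comm]

end LinComb

/-! ### Null sets and measurability under rescaled priors -/

section Prior

variable {p : ℕ} {q : E p → ℝ} {U : Set (E p)}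

theorem IsRegularPrior.ae_prior (hq : IsRegularPrior q) (hU : MeasurableSet U)
    (hball : Metric.closedBall (0 : E p) 1 ⊆ U) {P : E p → Prop}
    (h : ∀ᵐ x ∂(volume.restrict U), P x) : ∀ᵐ x ∂(priorMeasure q), P x := by
  rw [priorMeasure, ae_withDensity_iff hq.continuous.measurable.ennreal_ofReal]
  filter_upwards [(ae_restrict_iff' hU).1 h] with x hx h0
  refine hx (hball (hq.mem_closedBall fun h1 => h0 ?_))
  rw [h1, ENNReal.ofReal_zero]

theorem IsRegularPrior.ae_prior_mem (hq : IsRegularPrior q) :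
    ∀ᵐ x ∂(priorMeasure q), x ∈ Metric.closedBall (0 : E p) 1 :=
  hq.ae_prior Metric.isClosed_closedBall.measurableSet subset_rfl
    (ae_restrict_mem Metric.isClosed_closedBall.measurableSet)

theorem IsRegularPrior.aemeasurable_prior (hq : IsRegularPrior q) (hU : MeasurableSet U)
    (hball : Metric.closedBall (0 : E p) 1 ⊆ U) {f : E p → ℝ}
    (h : AEMeasurable f (volume.restrict U)) : AEMeasurable f (priorMeasure q) := by
  obtain ⟨g, hg, hfg⟩ := h
  exact ⟨g, hg, hq.ae_prior hU hball hfg⟩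

theorem ae_comp_affine {N : Set (E p)} (hN : MeasurableSet N) (x : E p) {κ : ℝ} (hκ : κ ≠ 0)
    {P : E p → Prop} (h : ∀ᵐ θ ∂(volume.restrict N), P θ) :
    ∀ᵐ u ∂(volume.restrict ((fun u => x + κ • u) ⁻¹' N)), P (x + κ • u) := by
  rw [ae_restrict_iff' hN] at h
  rw [ae_restrict_iff' ((quasiMeasurePreserving_affine volume x hκ).measurable hN)]
  filter_upwards [(quasiMeasurePreserving_affine volume x hκ).ae h] with u hu using hu

theorem aemeasurable_comp_affine {N : Set (E p)} (hN : MeasurableSet N) (x : E p) {κ : ℝ}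
    (hκ : κ ≠ 0) {f : E p → ℝ} (h : AEMeasurable f (volume.restrict N)) :
    AEMeasurable (fun u => f (x + κ • u)) (volume.restrict ((fun u => x + κ • u) ⁻¹' N)) := by
  obtain ⟨g, hg, hfg⟩ := h
  exact ⟨fun u => g (x + κ • u),
    hg.comp (quasiMeasurePreserving_affine volume x hκ).measurable, ae_comp_affine hN x hκ hfg⟩

end Prior

/-! ### The quadratic form of the Fisher information -/

section Info

variable {p : ℕ} {X : Type*} [MeasurableSpace X] {μ : Measure X} {g : Fin p → X → ℝ}

theorem dotProduct_fisherInfo (hg : ∀ i, MemLp (g i) 2 μ) (w : Fin p → ℝ) :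
    w ⬝ᵥ fisherInfo μ g *ᵥ w = 4 * ‖∑ i, w i • (hg i).toLp‖ ^ 2 := by
  rw [← real_inner_self_eq_norm_sq]
  simp only [sum_inner, inner_sum, real_inner_smul_left, real_inner_smul_right, dotProduct,
    Matrix.mulVec, DominatedModel.fisherInfo_eq_inner hg, Finset.mul_sum]
  refine Finset.sum_congr rfl fun i _ => Finset.sum_congr rfl fun j _ => ?_
  rw [real_inner_comm]
  ring

/-- Cauchy–Schwarz in `L²(μ)`. It makes integrability of the trace enough for that of every entry.
-/
theorem abs_fisherInfo_le_trace (hg : ∀ i, MemLp (g i) 2 μ) (i j : Fin p) :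
    |fisherInfo μ g i j| ≤ (fisherInfo μ g).trace := by
  simp only [Matrix.trace, Matrix.diag, DominatedModel.fisherInfo_eq_inner hg,
    real_inner_self_eq_norm_sq]
  rw [← Finset.mul_sum, abs_mul, abs_of_pos (by norm_num : (0 : ℝ) < 4)]
  have h1 : ∀ k, ‖(hg k).toLp‖ ^ 2 ≤ ∑ i, ‖(hg i).toLp‖ ^ 2 := fun k =>
    Finset.single_le_sum (f := fun i => ‖(hg i).toLp‖ ^ 2) (fun i _ => sq_nonneg _)
      (Finset.mem_univ k)
  have h2 := abs_real_inner_le_norm (hg i).toLp (hg j).toLp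
  nlinarith [h1 i, h1 j, sq_nonneg (‖(hg i).toLp‖ - ‖(hg j).toLp‖)]

end Info

/-! ### The van Trees inequality for an `n`-sample -/

section Sample

variable {p s : ℕ} {X : Type*} [MeasurableSpace X] {μ : Measure X} [SigmaFinite μ]
  {Θ : Set (E p)} {M : DominatedModel Θ μ} {θ₀ : E p} {N : Set (E p)}
  {dξ : E p → Fin p → X → ℝ} {ψ : E p → E s} {q : E p → ℝ}

theorem IsRegularPrior.integrable_fisherInfo (hq : IsRegularPrior q) (hΘ : IsOpen Θ)
    (hN : IsOpen N) (hNΘ : N ⊆ Θ) (hdξ : ∀ θ ∈ N, M.HasL2Partials θ (dξ θ)) {κ : ℝ}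
    (hball : ∀ h ∈ Metric.closedBall (0 : E p) 1, θ₀ + κ • h ∈ N)
    (htr : Integrable (fun h => (fisherInfo μ (dξ (θ₀ + κ • h))).trace) (priorMeasure q))
    (i j : Fin p) :
    Integrable (fun h => fisherInfo μ (dξ (θ₀ + κ • h)) i j) (priorMeasure q) := by
  obtain ⟨F, hF, hFe⟩ := M.exists_measurable_fisherInfo hΘ hN.measurableSet hNΘ hdξ i j
  refine htr.mono' ⟨fun h => F (θ₀ + κ • h), ?_, ?_⟩ ?_
  · exact (hF.comp ((measurable_id.const_smul κ).const_add θ₀)).stronglyMeasurable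
  · filter_upwards [hq.ae_prior_mem] with h hh
    exact (hFe _ (hball h hh)).symm
  · filter_upwards [hq.ae_prior_mem] with h hh
    exact abs_fisherInfo_le_trace (fun i => (hdξ _ (hball h hh) i).1) i j

theorem integral_sq_sub {Y : Type*} [MeasurableSpace Y] (ν : Measure Y) [IsProbabilityMeasure ν]
    {T : Y → ℝ} (hT : Measurable T) {C : ℝ} (hC : ∀ y, |T y| ≤ C) (b : ℝ) :
    ∫ y, (T y - b) ^ 2 ∂ν = ∫ y, T y ^ 2 ∂ν - 2 * b * ∫ y, T y ∂ν + b ^ 2 := by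
  have h1 : Integrable T ν := Integrable.of_bound hT.aestronglyMeasurable C
    (Eventually.of_forall hC)
  have h2 : Integrable (fun y => T y ^ 2) ν := by
    refine Integrable.of_bound (hT.pow_const 2).aestronglyMeasurable (C ^ 2)
      (Eventually.of_forall fun y => ?_)
    rw [norm_pow, Real.norm_eq_abs]
    gcongr
    exact hC y
  have h3 : ∀ y, (T y - b) ^ 2 = T y ^ 2 - 2 * b * T y + b ^ 2 := fun y => by ring
  simp only [h3]
  have h4 : Integrable (fun y => T y ^ 2 - 2 * b * T y) ν := h2.sub (h1.const_mul _)
  rw [integral_add h4 (integrable_const _), integral_sub h2 (h1.const_mul _), integral_const_mul]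
  simp

/-- The van Trees inequality for an `n`-sample, for a linear combination of the components of the
target and a bounded statistic. -/
theorem IsRegularPrior.vanTrees_sample (hq : IsRegularPrior q) (hΘ : IsOpen Θ) (hN : IsOpen N)
    (hNΘ : N ⊆ Θ) (hdξ : ∀ θ ∈ N, M.HasL2Partials θ (dξ θ))
    (hψm : AEMeasurable ψ (volume.restrict N)) (hψ : ∀ j : Fin s, IsNice N fun θ => ψ θ j)
    (hdψb : ∃ C : ℝ, ∀ᵐ θ ∂(volume.restrict N), ∀ i j, |grad ψ θ i j| ≤ C)
    {c : ℝ} {n : ℕ} (hc : 0 < c) (hn : 0 < n)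
    (hball : ∀ h ∈ Metric.closedBall (0 : E p) 1, θ₀ + (c / √(n : ℝ)) • h ∈ N)
    (htr : Integrable (fun h => (fisherInfo μ (dξ (θ₀ + (c / √(n : ℝ)) • h))).trace)
      (priorMeasure q))
    (a : Fin s → ℝ) {C : ℝ} (hC : ∀ θ ∈ N, |∑ j, a j * ψ θ j| ≤ C)
    {T : (Fin n → X) → ℝ} (hT : Measurable T) (hTC : ∀ x, |T x| ≤ C) :
    Integrable (fun h => ∫ x, (T x - ∑ j, a j * ψ (θ₀ + (c / √(n : ℝ)) • h) j) ^ 2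
      ∂(M.sampleLaw n (θ₀ + (c / √(n : ℝ)) • h))) (priorMeasure q) ∧
    a ⬝ᵥ Gam (fun θ => fisherInfo μ (dξ θ)) ψ q θ₀ c n *ᵥ a ≤
      n * ∫ h, (∫ x, (T x - ∑ j, a j * ψ (θ₀ + (c / √(n : ℝ)) • h) j) ^ 2
        ∂(M.sampleLaw n (θ₀ + (c / √(n : ℝ)) • h))) ∂(priorMeasure q) := by
  have hP := hq.isProbabilityMeasure
  set κ := c / √(n : ℝ) with hκdef
  have hn' : (0 : ℝ) < n := by exact_mod_cast hn
  have hκ : 0 < κ := by positivity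
  -- In the rescaled parameter, the sample information `n I_P` becomes `κ² n I_P = c² I_P`.
  have hκ2 : κ ^ 2 * n = c ^ 2 := by
    rw [hκdef, div_pow, Real.sq_sqrt hn'.le]; field_simp
  set A : E p → E p := fun h => θ₀ + κ • h with hA
  have hAc : Continuous A := by fun_prop
  set U : Set (E p) := A ⁻¹' N with hUdef
  have hU : IsOpen U := hN.preimage hAc
  have hballU : Metric.closedBall (0 : E p) 1 ⊆ U := hball
  set φ : E p → ℝ := fun θ => ∑ j, a j * ψ θ j with hφdef
  have hφn : IsNice N φ := IsNice.linComb hψ a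
  have hφm : AEMeasurable φ (volume.restrict N) :=
    Finset.aemeasurable_fun_sum _ fun j _ => (aemeasurable_component hψm j).const_mul _
  have hφm' : AEMeasurable (fun h => φ (A h)) (volume.restrict U) :=
    aemeasurable_comp_affine hN.measurableSet θ₀ hκ.ne' hφm
  have hφn' : IsNice U fun h => φ (A h) := hφn.comp_affine θ₀ hκ
  obtain ⟨D, hD⟩ := hdψb
  have hgrad : ∀ᵐ h ∂(volume.restrict U), HasPartials ψ (A h) ∧ ∀ i j, |grad ψ (A h) i j| ≤ D :=
    ae_comp_affine hN.measurableSet θ₀ hκ.ne' ((ae_hasPartials hN hψm hψ).and hD)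
  have hlin : ∀ i, ∀ᵐ h ∂(volume.restrict U), lineDeriv ℝ (fun h => φ (A h)) h (e i) =
      κ * ∑ j, grad ψ (A h) i j * a j := by
    intro i
    filter_upwards [hgrad] with h hh
    rw [lineDeriv_comp_affine, ← hh.1.lineDeriv_linComb]
  set m₀ : E p → ℝ := fun θ => ∫ x, T x ∂(M.sampleLaw n θ) with hm₀
  set R : E p → ℝ := fun h => ∫ x, (T x - φ (A h)) ^ 2 ∂(M.sampleLaw n (A h)) with hRdef
  have hCR : ∀ h ∈ U, _ := fun h hh =>
    (hdξ (A h) hh).cramerRao hΘ (hNΘ hh) n hT hTC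
  have hC0 : 0 ≤ C := by
    have := hC _ (hball 0 (Metric.mem_closedBall_self zero_le_one))
    exact (abs_nonneg _).trans this
  -- measurability of the mean and of the risk
  obtain ⟨F₁, hF₁, hF₁e⟩ := M.exists_measurable_mean hΘ.measurableSet n hT
  obtain ⟨F₂, hF₂, hF₂e⟩ := M.exists_measurable_mean hΘ.measurableSet n (hT.pow_const 2)
  have hm : AEMeasurable (fun h => m₀ (A h)) (volume.restrict U) := by
    refine ⟨fun h => F₁ (A h), hF₁.comp hAc.measurable, ?_⟩
    rw [EventuallyEq, ae_restrict_iff' hU.measurableSet]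
    exact Eventually.of_forall fun h hh => (hF₁e _ (hNΘ hh)).symm
  -- Expanding the square reduces the measurability of the risk to that of the first two moments of
  -- `T` and of `φ`.
  have hRm : AEMeasurable R (volume.restrict U) := by
    have h1 : AEMeasurable (fun h => F₂ (A h) - 2 * φ (A h) * F₁ (A h) + φ (A h) ^ 2)
        (volume.restrict U) :=
      ((hF₂.comp hAc.measurable).aemeasurable.sub ((hφm'.const_mul 2).mul
        (hF₁.comp hAc.measurable).aemeasurable)).add (hφm'.pow_const 2)
    refine h1.congr ?_
    rw [EventuallyEq, ae_restrict_iff' hU.measurableSet]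
    refine Eventually.of_forall fun h hh => ?_
    have := M.isProbabilityMeasure_sampleLaw n (hNΘ hh)
    rw [hRdef]
    simp only
    rw [integral_sq_sub _ hT hTC, hF₁e _ (hNΘ hh), hF₂e _ (hNΘ hh)]
  have hRi : Integrable R (priorMeasure q) := by
    refine Integrable.of_bound
      (hq.aemeasurable_prior hU.measurableSet hballU hRm).aestronglyMeasurable ((C + C) ^ 2) ?_
    filter_upwards [hq.ae_prior_mem] with h hh
    have := M.isProbabilityMeasure_sampleLaw n (hNΘ (hball h hh))
    refine (norm_integral_le_of_norm_le_const (C := (C + C) ^ 2)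
      (Eventually.of_forall fun x => ?_)).trans (by simp)
    rw [norm_pow, Real.norm_eq_abs]
    gcongr
    exact (abs_sub _ _).trans (add_le_add (hTC x) (hC _ (hball h hh)))
  have hR0 : 0 ≤ ∫ h, R h ∂(priorMeasure q) :=
    integral_nonneg fun h => integral_nonneg fun x => sq_nonneg _
  refine ⟨hRi, ?_⟩
  have hVT := hq.vanTrees (m := fun h => m₀ (A h)) (φ := fun h => φ (A h)) (R := R)
    (V := fun h => c ^ 2 • fisherInfo μ (dξ (A h))) (C := C) (D := κ * ∑ j, D * |a j|) hU hballU
    hm ?_ ?_ hφm' (fun h hh => hC _ hh) hφn' ?_ ?_ ?_ hRi ?_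
  rotate_left
  · intro h hh
    have := M.isProbabilityMeasure_sampleLaw n (hNΘ hh)
    have h3 := norm_integral_le_of_norm_le_const (μ := M.sampleLaw n (A h)) (f := T) (C := C)
      (Eventually.of_forall hTC)
    simpa [hm₀] using h3
  · intro h hh i
    exact ((hCR h hh).1 i).comp_affine
  · intro i
    filter_upwards [hlin i, hgrad] with h h1 h2
    rw [h1, abs_mul, abs_of_pos hκ]
    gcongr
    refine (Finset.abs_sum_le_sum_abs _ _).trans (Finset.sum_le_sum fun j _ => ?_)
    rw [abs_mul]
    gcongr
    exact h2.2 i j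
  · intro i j
    exact (hq.integrable_fisherInfo hΘ hN hNΘ hdξ hball htr i j).const_mul (c ^ 2)
  · intro h hh w
    rw [Matrix.smul_mulVec, dotProduct_smul, dotProduct_fisherInfo fun i => (hdξ _ hh i).1]
    simp only [smul_eq_mul]
    positivity
  · intro h hh w β
    -- The direction `κ w` absorbs the chain-rule factor of `h ↦ θ₀ + κ h`.
    have h1 := (hCR h hh).2 (κ • w) β (φ (A h))
    have h2 : (κ • w) ⬝ᵥ ((n : ℝ) • fisherInfo μ (dξ (A h))) *ᵥ (κ • w) =
        w ⬝ᵥ (c ^ 2 • fisherInfo μ (dξ (A h))) *ᵥ w := by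
      rw [Matrix.smul_mulVec, Matrix.smul_mulVec, Matrix.mulVec_smul]
      simp only [smul_dotProduct, dotProduct_smul, smul_eq_mul, ← hκ2]
      ring
    rw [h2] at h1
    refine le_of_eq_of_le ?_ h1
    congr 2
    refine Finset.sum_congr rfl fun i _ => ?_
    rw [lineDeriv_comp_affine, Pi.smul_apply, smul_eq_mul]
    ring
  set I : E p → Matrix (Fin p) (Fin p) ℝ := fun θ => fisherInfo μ (dξ θ) with hI
  set J := avgInfo I q θ₀ c n with hJ
  set G := avgGrad ψ q θ₀ c n with hG
  have hJe : priorInfo q + Matrix.of (fun i j => ∫ h, (c ^ 2 • fisherInfo μ (dξ (A h))) i j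
      ∂(priorMeasure q)) = c ^ 2 • J := by
    ext i j
    simp only [hJ, avgInfo, Matrix.add_apply, Matrix.smul_apply, Matrix.of_apply, smul_eq_mul,
      integral_const_mul, hI, hA, hκdef]
    field_simp
  have hGe : ∀ i, ∫ h, lineDeriv ℝ (fun h => φ (A h)) h (e i) ∂(priorMeasure q) =
      κ * (G *ᵥ a) i := by
    intro i
    rw [integral_congr_ae (hq.ae_prior hU.measurableSet hballU (hlin i)), integral_const_mul,
      integral_finsetSum]
    · simp only [integral_mul_const, hG, Matrix.mulVec, dotProduct, avgGrad, Matrix.of_apply, hA,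
        hκdef]
    · intro j _
      refine Integrable.mul_const (Integrable.of_bound (hq.aemeasurable_prior hU.measurableSet
        hballU (aemeasurable_comp_affine hN.measurableSet θ₀ hκ.ne'
          (aemeasurable_grad hN hψm hψ i j))).aestronglyMeasurable D ?_) _
      filter_upwards [hq.ae_prior hU.measurableSet hballU hgrad] with h hh using hh.2 i j
  set γ := G *ᵥ a with hγ
  have hτ : a ⬝ᵥ Gam I ψ q θ₀ c n *ᵥ a = γ ⬝ᵥ J⁻¹ *ᵥ γ := by
    rw [Gam, hγ, ← Matrix.mulVec_mulVec, ← Matrix.mulVec_mulVec, Matrix.dotProduct_mulVec,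
      Matrix.vecMul_transpose]
  rw [hτ]
  clear_value γ
  -- For singular `J` the matrix inverse has the default value `0`, and the bound is trivial.
  by_cases hdet : IsUnit J.det
  -- The optimal direction: with `τ = γᵀ J⁻¹ γ`, the inequality reads `κ² τ² ≤ (∫ R) c² τ`. Dividing
  -- by `κ² τ` when `τ > 0` gives the claim; the case `τ ≤ 0` is immediate, so no positivity of `J`
  -- is involved.
  · have h1 := hVT (J⁻¹ *ᵥ γ)
    rw [hJe, Matrix.smul_mulVec, dotProduct_smul, Matrix.mulVec_mulVec,
      Matrix.mul_nonsing_inv _ hdet, Matrix.one_mulVec, smul_eq_mul, dotProduct_comm] at h1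
    have h2 : ∑ i, (J⁻¹ *ᵥ γ) i * ∫ h, lineDeriv ℝ (fun h => φ (A h)) h (e i) ∂(priorMeasure q) =
        κ * (γ ⬝ᵥ J⁻¹ *ᵥ γ) := by
      simp only [hGe, dotProduct, Finset.mul_sum]
      exact Finset.sum_congr rfl fun i _ => by ring
    rw [h2, mul_pow] at h1
    set τ := γ ⬝ᵥ J⁻¹ *ᵥ γ
    by_cases hτ0 : τ ≤ 0
    · exact hτ0.trans (by positivity)
    · push Not at hτ0
      have h3 : κ ^ 2 * τ * τ ≤ κ ^ 2 * τ * (n * ∫ h, R h ∂(priorMeasure q)) := by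
        calc κ ^ 2 * τ * τ = κ ^ 2 * τ ^ 2 := by ring
          _ ≤ _ := h1
          _ = _ := by rw [← hκ2]; ring
      exact le_of_mul_le_mul_left h3 (by positivity)
  · rw [Matrix.nonsing_inv_apply_not_isUnit _ hdet]
    simp only [Matrix.zero_mulVec, dotProduct_zero]
    positivity

end Sample


/-! ### Quadratic losses -/

-- The matrix of the associated symmetric bilinear form is positive semidefinite, hence of the form
-- `bᵀ b`; the rows of `b` are the linear forms.
open scoped MatrixOrder in
theorem exists_sum_sq_of_nonneg {s : ℕ} (ℓ : QuadraticForm ℝ (E s)) (hℓ : ∀ v, 0 ≤ ℓ v) :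
    ∃ b : Fin s → Fin s → ℝ, ∀ v : E s, ℓ v = ∑ k, (∑ j, b k j * v j) ^ 2 := by
  set B := QuadraticMap.associated (R := ℝ) ℓ with hB
  set A : Matrix (Fin s) (Fin s) ℝ := Matrix.of fun j k => B (e j) (e k) with hA
  have hv : ∀ x : Fin s → ℝ, x ⬝ᵥ A *ᵥ x = ℓ (WithLp.toLp 2 x) := by
    intro x
    have h1 : WithLp.toLp 2 x = ∑ j, x j • (e j : E s) := by
      ext k
      simp [e, Pi.single_apply]
    rw [← QuadraticMap.associated_eq_self_apply ℝ ℓ, h1]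
    simp only [map_sum, map_smul, LinearMap.sum_apply, LinearMap.smul_apply, smul_eq_mul,
      dotProduct, Matrix.mulVec, hA, Matrix.of_apply, Finset.mul_sum, hB]
    rw [Finset.sum_comm]
    refine Finset.sum_congr rfl fun i _ => Finset.sum_congr rfl fun j _ => ?_
    ring
  have hpsd : A.PosSemidef := by
    refine Matrix.PosSemidef.of_dotProduct_mulVec_nonneg ?_ ?_
    · ext j k
      simp only [Matrix.conjTranspose_apply, hA, Matrix.of_apply, star_trivial]
      exact QuadraticMap.associated_isSymm ℝ ℓ _ _
    · intro x
      rw [star_trivial, hv]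
      exact hℓ _
  obtain ⟨b, hb⟩ := CStarAlgebra.nonneg_iff_eq_star_mul_self.mp hpsd.nonneg
  refine ⟨fun k j => b k j, fun v => ?_⟩
  have h2 := hv v
  rw [hb, Matrix.star_eq_conjTranspose, Matrix.conjTranspose_eq_transpose_of_trivial, ← Matrix.mulVec_mulVec,
    Matrix.dotProduct_mulVec, Matrix.vecMul_transpose] at h2
  simp only [dotProduct, Matrix.mulVec] at h2
  rw [WithLp.toLp_ofLp] at h2
  rw [← h2]
  exact Finset.sum_congr rfl fun k _ => (sq _).symm

/-- The linear form `b k` is centred under the Gaussian law, with variance `b kᵀ S b k`. -/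
theorem lintegral_sum_sq_multivariateGaussian {s : ℕ} {S : Matrix (Fin s) (Fin s) ℝ}
    (hS : S.PosSemidef) (b : Fin s → Fin s → ℝ) :
    ∫⁻ v, ENNReal.ofReal (∑ k, (∑ j, b k j * v j) ^ 2) ∂(multivariateGaussian 0 S) =
      ENNReal.ofReal (∑ k, b k ⬝ᵥ S *ᵥ b k) := by
  have hinner : ∀ (k : Fin s) (v : E s), ∑ j, b k j * v j = inner ℝ (WithLp.toLp 2 (b k)) v := by
    intro k v
    simp [PiLp.inner_apply, mul_comm]
  have hid : MemLp id 2 (multivariateGaussian (0 : E s) S) := IsGaussian.memLp_two_id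
  have hi : ∀ k, Integrable (fun v : E s => inner ℝ (WithLp.toLp 2 (b k)) v ^ 2)
      (multivariateGaussian 0 S) := fun k =>
    (hid.const_inner (WithLp.toLp 2 (b k))).integrable_sq
  have hint : ∀ k, ∫ v : E s, inner ℝ (WithLp.toLp 2 (b k)) v ^ 2 ∂(multivariateGaussian 0 S) =
      b k ⬝ᵥ S *ᵥ b k := by
    intro k
    have h := covarianceBilin_multivariateGaussian (μ := 0) hS (WithLp.toLp 2 (b k))
      (WithLp.toLp 2 (b k))
    rw [covarianceBilin_apply hid] at h
    simp only [integral_id_multivariateGaussian', sub_zero] at h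
    rw [← h]
    simp only [sq]
  simp only [hinner]
  rw [← ofReal_integral_eq_lintegral_ofReal (integrable_finsetSum _ fun k _ => hi k)
    (Eventually.of_forall fun v => Finset.sum_nonneg fun k _ => sq_nonneg _),
    integral_finsetSum _ fun k _ => hi k]
  simp only [hint]

/-- Projection onto an interval brings a point closer to every point of it. This reduces arbitrary
statistics to bounded ones. -/
theorem sq_clip_sub_le {x b C : ℝ} (hb : |b| ≤ C) : (max (-C) (min C x) - b) ^ 2 ≤ (x - b) ^ 2 := by
  rw [abs_le] at hb
  have h1 : -C ≤ C := hb.1.trans hb.2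
  rcases le_total x C with h | h
  · rw [min_eq_right h]
    rcases le_total x (-C) with h' | h'
    · rw [max_eq_left h']; nlinarith
    · rw [max_eq_right h']
  · rw [min_eq_left h, max_eq_right h1]; nlinarith

theorem posSemidef_fisherInfo {p : ℕ} {X : Type*} [MeasurableSpace X] {μ : Measure X}
    {g : Fin p → X → ℝ} (hg : ∀ i, MemLp (g i) 2 μ) : (fisherInfo μ g).PosSemidef := by
  refine Matrix.PosSemidef.of_dotProduct_mulVec_nonneg ?_ ?_
  · ext i j
    simp only [Matrix.conjTranspose_apply, star_trivial, fisherInfo, Matrix.of_apply, mul_comm]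
  · intro w
    rw [star_trivial, dotProduct_fisherInfo hg]
    positivity

/-! ### From Bayes risks to the maximal risk -/

section LowerBound

variable {p s : ℕ} {X : Type*} [MeasurableSpace X] {μ : Measure X} [SigmaFinite μ]
  {Θ : Set (E p)} {M : DominatedModel Θ μ} {θ₀ : E p} {N : Set (E p)}
  {dξ : E p → Fin p → X → ℝ} {ψ : E p → E s} {q : E p → ℝ}

theorem tendsto_div_sqrt_atTop (c : ℝ) :
    Tendsto (fun n : ℕ => c / √(n : ℝ)) atTop (𝓝 0) :=
  tendsto_const_nhds.div_atTop (Real.tendsto_sqrt_atTop.comp tendsto_natCast_atTop_atTop)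

theorem eventually_affine_mem (hN : IsOpen N) (hθ₀ : θ₀ ∈ N) {c : ℝ} (hc : 0 < c) :
    ∀ᶠ n : ℕ in atTop, ∀ h ∈ Metric.closedBall (0 : E p) 1, θ₀ + (c / √(n : ℝ)) • h ∈ N := by
  obtain ⟨ε, hε, hb⟩ := Metric.isOpen_iff.1 hN θ₀ hθ₀
  filter_upwards [(tendsto_div_sqrt_atTop c).eventually (gt_mem_nhds hε)] with n hn h hh
  refine hb ?_
  rw [mem_closedBall_zero_iff] at hh
  rw [mem_ball_iff_norm, add_sub_cancel_left, norm_smul, Real.norm_of_nonneg (by positivity)]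
  have : 0 ≤ c / √(n : ℝ) := by positivity
  nlinarith

/-- The rescaled prior is carried by parameters with `√n ‖θ - θ₀‖ ≤ c`, so the supremum dominates
the average risk, to which the van Trees inequality applies for each linear form `b k`. -/
theorem IsRegularPrior.ofReal_le_maxRisk (hq : IsRegularPrior q) (hΘ : IsOpen Θ) (hN : IsOpen N)
    (hNΘ : N ⊆ Θ) (hdξ : ∀ θ ∈ N, M.HasL2Partials θ (dξ θ))
    (hψm : AEMeasurable ψ (volume.restrict N)) (hψ : ∀ j : Fin s, IsNice N fun θ => ψ θ j)
    (hψb : ∃ C : ℝ, ∀ θ ∈ N, ‖ψ θ‖ ≤ C)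
    (hdψb : ∃ C : ℝ, ∀ᵐ θ ∂(volume.restrict N), ∀ i j, |grad ψ θ i j| ≤ C)
    {c : ℝ} {n : ℕ} (hc : 0 < c) (hn : 0 < n)
    (hball : ∀ h ∈ Metric.closedBall (0 : E p) 1, θ₀ + (c / √(n : ℝ)) • h ∈ N)
    (htr : Integrable (fun h => (fisherInfo μ (dξ (θ₀ + (c / √(n : ℝ)) • h))).trace)
      (priorMeasure q))
    {ℓ : QuadraticForm ℝ (E s)} {b : Fin s → Fin s → ℝ}
    (hb : ∀ v : E s, ℓ v = ∑ k, (∑ j, b k j * v j) ^ 2)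
    {S : (Fin n → X) → E s} (hS : Measurable S) :
    ENNReal.ofReal (∑ k, b k ⬝ᵥ Gam (fun θ => fisherInfo μ (dξ θ)) ψ q θ₀ c n *ᵥ b k) ≤
      M.maxRisk ψ ℓ θ₀ c n S := by
  have hP := hq.isProbabilityMeasure
  by_cases htop : M.maxRisk ψ ℓ θ₀ c n S = ∞
  · rw [htop]; exact le_top
  have hn' : (0 : ℝ) < n := by exact_mod_cast hn
  obtain ⟨C₀, hC₀⟩ := hψb
  set C : Fin s → ℝ := fun k => ∑ j, |b k j| * C₀ with hCdef
  have hC : ∀ k, ∀ θ ∈ N, |∑ j, b k j * ψ θ j| ≤ C k := by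
    intro k θ hθ
    refine (Finset.abs_sum_le_sum_abs _ _).trans (Finset.sum_le_sum fun j _ => ?_)
    rw [abs_mul]
    gcongr
    exact (PiLp.norm_apply_le (ψ θ) j).trans (hC₀ θ hθ)
  have hC0 : ∀ k, 0 ≤ C k := fun k =>
    (abs_nonneg _).trans (hC k _ (hball 0 (Metric.mem_closedBall_self zero_le_one)))
  -- The estimator `b k · S` of `b k · ψ`, clipped to `[-C k, C k]`, an interval that contains the
  -- values of the target on `N`.
  set T : Fin s → (Fin n → X) → ℝ := fun k x =>
    max (-C k) (min (C k) (∑ j, b k j * S x j)) with hTdef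
  have hSm : ∀ j, Measurable fun x => S x j := fun j =>
    (EuclideanSpace.proj (𝕜 := ℝ) j).continuous.measurable.comp hS
  have hT : ∀ k, Measurable (T k) := fun k =>
    measurable_const.max (measurable_const.min
      (Finset.measurable_fun_sum _ fun j _ => (hSm j).const_mul _))
  have hTC : ∀ k x, |T k x| ≤ C k := by
    intro k x
    rw [abs_le]
    exact ⟨le_max_left _ _, max_le (by linarith [hC0 k]) (min_le_left _ _)⟩
  have hVT := fun k => hq.vanTrees_sample hΘ hN hNΘ hdξ hψm hψ hdψb hc hn hball htr (b k) (hC k)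
    (hT k) (hTC k)
  rw [← ENNReal.ofReal_toReal htop]
  refine ENNReal.ofReal_le_ofReal ((Finset.sum_le_sum fun k _ => (hVT k).2).trans ?_)
  rw [← Finset.mul_sum, ← integral_finsetSum _ fun k _ => (hVT k).1, ← integral_const_mul]
  have hle : ∀ᵐ h ∂(priorMeasure q), (n : ℝ) * ∑ k,
      ∫ x, (T k x - ∑ j, b k j * ψ (θ₀ + (c / √(n : ℝ)) • h) j) ^ 2
        ∂(M.sampleLaw n (θ₀ + (c / √(n : ℝ)) • h)) ≤ (M.maxRisk ψ ℓ θ₀ c n S).toReal := by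
    filter_upwards [hq.ae_prior_mem] with h hh
    set θ := θ₀ + (c / √(n : ℝ)) • h with hθ
    have hθN : θ ∈ N := hball h hh
    have hPθ := M.isProbabilityMeasure_sampleLaw n (hNΘ hθN)
    have hi : ∀ k, Integrable (fun x => (T k x - ∑ j, b k j * ψ θ j) ^ 2) (M.sampleLaw n θ) := by
      intro k
      refine Integrable.of_bound (((hT k).sub_const _).pow_const 2).aestronglyMeasurable
        ((C k + C k) ^ 2) (Eventually.of_forall fun x => ?_)
      rw [norm_pow, Real.norm_eq_abs]
      gcongr
      exact (abs_sub _ _).trans (add_le_add (hTC k x) (hC k _ hθN))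
    rw [← integral_finsetSum _ fun k _ => hi k, ← integral_const_mul]
    rw [← ENNReal.ofReal_le_iff_le_toReal htop, ofReal_integral_eq_lintegral_ofReal
      ((integrable_finsetSum _ fun k _ => hi k).const_mul _)
      (Eventually.of_forall fun x => mul_nonneg hn'.le
        (Finset.sum_nonneg fun k _ => sq_nonneg _))]
    have hmem : θ ∈ {θ : E p | θ ∈ Θ ∧ √(n : ℝ) * ‖θ - θ₀‖ ≤ c} := by
      refine ⟨hNΘ hθN, ?_⟩
      rw [mem_closedBall_zero_iff] at hh
      rw [hθ, add_sub_cancel_left, norm_smul, Real.norm_of_nonneg (by positivity), ← mul_assoc,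
        mul_div_cancel₀ _ (Real.sqrt_pos.2 hn').ne']
      nlinarith
    refine le_trans (lintegral_mono fun x => ENNReal.ofReal_le_ofReal ?_)
      (le_iSup₂ (f := fun (θ : E p) (_ : θ ∈ {θ : E p | θ ∈ Θ ∧ √(n : ℝ) * ‖θ - θ₀‖ ≤ c}) =>
        ∫⁻ x, ENNReal.ofReal (ℓ (√(n : ℝ) • (S x - ψ θ))) ∂(M.sampleLaw n θ)) θ hmem)
    rw [hb, Finset.mul_sum]
    refine Finset.sum_le_sum fun k _ => ?_
    have h1 : ∑ j, b k j * (√(n : ℝ) • (S x - ψ θ)) j =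
        √(n : ℝ) * (∑ j, b k j * S x j - ∑ j, b k j * ψ θ j) := by
      rw [← Finset.sum_sub_distrib, Finset.mul_sum]
      refine Finset.sum_congr rfl fun j _ => ?_
      simp only [PiLp.smul_apply, PiLp.sub_apply, smul_eq_mul]
      ring
    rw [h1, mul_pow, Real.sq_sqrt hn'.le]
    exact mul_le_mul_of_nonneg_left (sq_clip_sub_le (hC k θ hθN)) hn'.le
  refine (integral_mono_ae ((integrable_finsetSum _ fun k _ => (hVT k).1).const_mul _)
    (integrable_const _) hle).trans ?_
  simp

/-- The bound for fixed `c` and `n` is a continuous function of `Γ`, so both limits pass through it;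
liminf is monotone. -/
theorem GamConverges.lintegral_le_liminf_maxRisk
    (hΓ : GamConverges (fun θ => fisherInfo μ (dξ θ)) ψ q θ₀) (hq : IsRegularPrior q)
    (hΘ : IsOpen Θ) (hN : IsOpen N) (hNΘ : N ⊆ Θ) (hθ₀ : θ₀ ∈ N)
    (hdξ : ∀ θ ∈ N, M.HasL2Partials θ (dξ θ))
    (hψm : AEMeasurable ψ (volume.restrict N)) (hψ : ∀ j : Fin s, IsNice N fun θ => ψ θ j)
    (hψb : ∃ C : ℝ, ∀ θ ∈ N, ‖ψ θ‖ ≤ C)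
    (hdψb : ∃ C : ℝ, ∀ᵐ θ ∂(volume.restrict N), ∀ i j, |grad ψ θ i j| ≤ C)
    {ℓ : QuadraticForm ℝ (E s)} (hℓ : ∀ v, 0 ≤ ℓ v)
    {S : (n : ℕ) → (Fin n → X) → E s} (hS : ∀ n, Measurable (S n)) :
    ∫⁻ v, ENNReal.ofReal (ℓ v) ∂(multivariateGaussian 0
        (limitCov (fun θ => fisherInfo μ (dξ θ)) ψ θ₀)) ≤
      liminf (fun c : ℝ => liminf (fun n : ℕ => M.maxRisk ψ ℓ θ₀ c n (S n)) atTop) atTop := by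
  obtain ⟨b, hb⟩ := exists_sum_sq_of_nonneg ℓ hℓ
  have hpsd : (limitCov (fun θ => fisherInfo μ (dξ θ)) ψ θ₀).PosSemidef := by
    have := (posSemidef_fisherInfo fun i => (hdξ θ₀ hθ₀ i).1).inv.conjTranspose_mul_mul_same
      (grad ψ θ₀)
    rwa [Matrix.conjTranspose_eq_transpose_of_trivial] at this
  simp only [hb]
  rw [lintegral_sum_sq_multivariateGaussian hpsd]
  set f : Matrix (Fin s) (Fin s) ℝ → ℝ≥0∞ := fun A => ENNReal.ofReal (∑ k, b k ⬝ᵥ A *ᵥ b k)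
    with hf
  have hfc : Continuous f := by
    refine ENNReal.continuous_ofReal.comp (continuous_finsetSum _ fun k _ => ?_)
    exact continuous_const.dotProduct (continuous_id.matrix_mulVec continuous_const)
  obtain ⟨L, hL1, hL2⟩ := hΓ.tendsto
  have h1 : Tendsto (fun c => f (L c)) atTop
      (𝓝 (f (limitCov (fun θ => fisherInfo μ (dξ θ)) ψ θ₀))) := (hfc.tendsto _).comp hL2
  change f (limitCov (fun θ => fisherInfo μ (dξ θ)) ψ θ₀) ≤ _
  rw [← h1.liminf_eq]
  refine liminf_le_liminf ?_
  filter_upwards [hL1, hΓ.integrable, eventually_gt_atTop 0] with c hc1 hc2 hc0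
  rw [← ((hfc.tendsto _).comp hc1).liminf_eq]
  refine liminf_le_liminf ?_
  filter_upwards [hc2, eventually_affine_mem hN hθ₀ hc0, eventually_gt_atTop 0] with n h2 h3 h4
  exact hq.ofReal_le_maxRisk hΘ hN hNΘ hdξ hψm hψ hψb hdψb hc0 h4 h3 h2 hb (hS n)

end LowerBound


/-! ### Existence of regular priors -/

theorem isNice_of_contDiff {p : ℕ} {f : E p → ℝ} (hf : ContDiff ℝ 1 f) (D : Set (E p)) :
    IsNice D f := by
  intro i
  refine Eventually.of_forall fun v a b _ _ => ?_
  have hline : ContDiff ℝ 1 fun t : ℝ => glue i t v := by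
    have h : (fun t : ℝ => glue i t v) = fun t => glue i 0 v + t • e i := by
      funext t
      rw [← glue_add, zero_add]
    rw [h]
    fun_prop
  exact (hf.comp hline).contDiffOn.absolutelyContinuousOnInterval

/-- The square of a smooth bump `B`, normalised: for `q = B² / Z` the quotient `‖∇q‖² / q` equals `4
‖∇B‖² / Z` where `q > 0`, so nothing blows up where `B` vanishes. -/
theorem exists_isRegularPrior (p : ℕ) : ∃ q : E p → ℝ, IsRegularPrior q := by
  let B : ContDiffBump (0 : E p) := ⟨1 / 2, 1, by norm_num, by norm_num⟩
  have hB1 : ContDiff ℝ 1 B := B.contDiff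
  have hcs : HasCompactSupport fun u => B u ^ 2 := by
    have := B.hasCompactSupport.mul_left (f := B)
    simpa only [sq] using! this
  have hc : Continuous fun u => B u ^ 2 := B.continuous.pow 2
  have hi : Integrable fun u => B u ^ 2 := hc.integrable_of_hasCompactSupport hcs
  set Z := ∫ u, B u ^ 2 with hZ
  have hZ0 : 0 < Z := by
    refine hc.integral_pos_of_hasCompactSupport_nonneg_nonzero hcs (fun u => sq_nonneg _)
      (x := 0) ?_
    rw [B.one_of_mem_closedBall (Metric.mem_closedBall_self B.rIn_pos.le)]
    norm_num
  have hderiv : ∀ u i, lineDeriv ℝ (fun u => Z⁻¹ * B u ^ 2) u (e i) =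
      Z⁻¹ * (2 * B u * fderiv ℝ B u (e i)) := by
    intro u i
    have h1 : HasLineDerivAt ℝ B (fderiv ℝ B u (e i)) u (e i) :=
      (hB1.differentiable one_ne_zero u).hasFDerivAt.hasLineDerivAt _
    have h2 := (h1.fun_pow 2).const_mul Z⁻¹
    refine HasLineDerivAt.lineDeriv (HasDerivAt.congr_deriv h2 ?_)
    simp
  refine ⟨fun u => Z⁻¹ * B u ^ 2, ?_, ?_, ?_, ?_, ?_, ?_⟩
  · exact hc.const_mul _
  · intro u; positivity
  · rw [← ofReal_integral_eq_lintegral_ofReal (hi.const_mul _)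
      (Eventually.of_forall fun u => by positivity), integral_const_mul, ← hZ,
      inv_mul_cancel₀ hZ0.ne', ENNReal.ofReal_one]
  · intro u hu
    have : B u = 0 := B.zero_of_le_dist (by rw [dist_zero_right]; exact hu.le)
    simp [this]
  · exact isNice_of_contDiff (contDiff_const.mul (hB1.pow 2)) _
  · have hfd : Continuous (fderiv ℝ B) := hB1.continuous_fderiv one_ne_zero
    have hmeas : MeasurableSet {u : E p | 0 < Z⁻¹ * B u ^ 2} :=
      measurableSet_lt measurable_const (hc.const_mul _).measurable
    have hint : ∀ i : Fin p, Integrable fun u => fderiv ℝ B u (e i) * fderiv ℝ B u (e i) := by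
      intro i
      have hcont : Continuous fun u => fderiv ℝ B u (e i) := hfd.clm_apply continuous_const
      have hsupp : HasCompactSupport fun u => fderiv ℝ B u (e i) :=
        B.hasCompactSupport.fderiv_apply ℝ (e i)
      exact (hcont.mul hcont).integrable_of_hasCompactSupport (hsupp.mul_left)
    have hI : Integrable ({u : E p | 0 < Z⁻¹ * B u ^ 2}.indicator fun u =>
        4 * Z⁻¹ * ∑ i, fderiv ℝ B u (e i) * fderiv ℝ B u (e i)) :=
      ((integrable_finsetSum _ fun i _ => hint i).const_mul _).indicator hmeas
    refine hI.congr (Eventually.of_forall fun u => ?_)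
    beta_reduce
    by_cases hu : u ∈ {u : E p | 0 < Z⁻¹ * B u ^ 2}
    · rw [Set.indicator_of_mem hu, Set.indicator_of_mem hu]
      have hBu : B u ≠ 0 := by
        intro h
        have : (0 : ℝ) < Z⁻¹ * B u ^ 2 := hu
        rw [h] at this
        simp at this
      simp only [hderiv]
      rw [Finset.mul_sum, Finset.sum_div]
      refine Finset.sum_congr rfl fun i _ => ?_
      field_simp
      ring
    · rw [Set.indicator_of_notMem hu, Set.indicator_of_notMem hu]

/-! ### Convergence under continuity -/

section Continuity

variable {p s : ℕ} {q : E p → ℝ} {N : Set (E p)} {θ₀ : E p}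

/-- For `n` large the rescaled prior lives within `δ` of `θ₀`, where `f` is `ε`-close to `l`.
Closeness is asked only almost everywhere, which suits `∇ψ` and suffices because the prior has a
density. -/
theorem IsRegularPrior.tendsto_integral_affine (hq : IsRegularPrior q) (hN : IsOpen N)
    (hθ₀ : θ₀ ∈ N) {f : E p → ℝ} {l : ℝ} (hf : AEMeasurable f (volume.restrict N))
    (hl : ∀ ε > 0, ∃ δ > 0, ∀ᵐ θ ∂(volume.restrict N), dist θ θ₀ < δ → |f θ - l| ≤ ε)
    {c : ℝ} (hc : 0 < c) :
    (∀ᶠ n : ℕ in atTop, Integrable (fun h => f (θ₀ + (c / √(n : ℝ)) • h)) (priorMeasure q)) ∧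
      Tendsto (fun n : ℕ => ∫ h, f (θ₀ + (c / √(n : ℝ)) • h) ∂(priorMeasure q)) atTop (𝓝 l) := by
  have hP := hq.isProbabilityMeasure
  have key : ∀ ε > 0, ∀ᶠ n : ℕ in atTop,
      AEMeasurable (fun h => f (θ₀ + (c / √(n : ℝ)) • h)) (priorMeasure q) ∧
      ∀ᵐ h ∂(priorMeasure q), |f (θ₀ + (c / √(n : ℝ)) • h) - l| ≤ ε := by
    intro ε hε
    obtain ⟨δ, hδ, hae⟩ := hl ε hε
    filter_upwards [eventually_affine_mem hN hθ₀ hc,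
      (tendsto_div_sqrt_atTop c).eventually (gt_mem_nhds hδ), eventually_gt_atTop 0] with n h1 h2 h3
    have hκ : 0 < c / √(n : ℝ) := by
      have : (0 : ℝ) < n := by exact_mod_cast h3
      positivity
    have hU : MeasurableSet ((fun h : E p => θ₀ + (c / √(n : ℝ)) • h) ⁻¹' N) :=
      (quasiMeasurePreserving_affine volume θ₀ hκ.ne').measurable hN.measurableSet
    refine ⟨hq.aemeasurable_prior hU h1
      (aemeasurable_comp_affine hN.measurableSet θ₀ hκ.ne' hf), ?_⟩
    filter_upwards [hq.ae_prior hU h1 (ae_comp_affine hN.measurableSet θ₀ hκ.ne' hae),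
      hq.ae_prior_mem] with h h4 h5
    refine h4 ?_
    rw [mem_closedBall_zero_iff] at h5
    rw [dist_eq_norm, add_sub_cancel_left, norm_smul, Real.norm_of_nonneg hκ.le]
    nlinarith
  have hint : ∀ ε > 0, ∀ n : ℕ,
      AEMeasurable (fun h => f (θ₀ + (c / √(n : ℝ)) • h)) (priorMeasure q) →
      (∀ᵐ h ∂(priorMeasure q), |f (θ₀ + (c / √(n : ℝ)) • h) - l| ≤ ε) →
      Integrable (fun h => f (θ₀ + (c / √(n : ℝ)) • h)) (priorMeasure q) := by
    intro ε _ n h1 h2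
    refine Integrable.of_bound h1.aestronglyMeasurable (ε + |l|) ?_
    filter_upwards [h2] with h hh
    rw [Real.norm_eq_abs]
    have := abs_sub_abs_le_abs_sub (f (θ₀ + (c / √(n : ℝ)) • h)) l
    linarith
  refine ⟨?_, ?_⟩
  · filter_upwards [key 1 one_pos] with n hn using hint 1 one_pos n hn.1 hn.2
  · rw [Metric.nhds_basis_closedBall.tendsto_right_iff]
    intro ε hε
    filter_upwards [key ε hε] with n hn
    rw [Metric.mem_closedBall, Real.dist_eq]
    have h1 : ∫ h, f (θ₀ + (c / √(n : ℝ)) • h) ∂(priorMeasure q) - l =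
        ∫ h, (f (θ₀ + (c / √(n : ℝ)) • h) - l) ∂(priorMeasure q) := by
      rw [integral_sub (hint ε hε n hn.1 hn.2) (integrable_const _)]
      simp
    rw [h1]
    have h2 := norm_integral_le_of_norm_le_const (μ := priorMeasure q)
      (f := fun h => f (θ₀ + (c / √(n : ℝ)) • h) - l) hn.2
    rwa [probReal_univ, mul_one, Real.norm_eq_abs] at h2

theorem tendsto_matrix_iff {α : Type*} {m n : Type*} {l : Filter α} {f : α → Matrix m n ℝ}
    {A : Matrix m n ℝ} :
    Tendsto f l (𝓝 A) ↔ ∀ i j, Tendsto (fun x => f x i j) l (𝓝 (A i j)) :=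
  tendsto_pi_nhds.trans (forall_congr' fun _ => tendsto_pi_nhds)

theorem tendsto_matrix_mul {α : Type*} {k m n : Type*} [Fintype m] {l : Filter α}
    {f : α → Matrix k m ℝ} {g : α → Matrix m n ℝ} {A : Matrix k m ℝ} {B : Matrix m n ℝ}
    (hf : Tendsto f l (𝓝 A)) (hg : Tendsto g l (𝓝 B)) :
    Tendsto (fun x => f x * g x) l (𝓝 (A * B)) :=
  ((continuous_fst.matrix_mul continuous_snd).tendsto (A, B)).comp (hf.prodMk_nhds hg)

variable {X : Type*} [MeasurableSpace X] {μ : Measure X} [SigmaFinite μ]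
  {Θ : Set (E p)} {M : DominatedModel Θ μ} {dξ : E p → Fin p → X → ℝ} {ψ : E p → E s}

/-- As `n → ∞` the averages of `∇ψ` and `I_P` tend to their values at `θ₀`, leaving only `I_H / c²`,
which disappears as `c → ∞`. Inversion is continuous at invertible matrices. -/
theorem IsRegularPrior.gamConverges (hq : IsRegularPrior q) (hΘ : IsOpen Θ) (hN : IsOpen N)
    (hNΘ : N ⊆ Θ) (hθ₀ : θ₀ ∈ N) (hdξ : ∀ θ ∈ N, M.HasL2Partials θ (dξ θ))
    (hψm : AEMeasurable ψ (volume.restrict N)) (hψ : ∀ j : Fin s, IsNice N fun θ => ψ θ j)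
    (hgc : ContinuousWithinAt (grad ψ) {θ | θ ∈ N ∧ HasPartials ψ θ} θ₀)
    (hIc : ContinuousAt (fun θ => fisherInfo μ (dξ θ)) θ₀)
    (hdet : IsUnit (fisherInfo μ (dξ θ₀)).det) :
    GamConverges (fun θ => fisherInfo μ (dξ θ)) ψ q θ₀ := by
  have hGlim : ∀ i j, ∀ ε > 0, ∃ δ > 0, ∀ᵐ θ ∂(volume.restrict N), dist θ θ₀ < δ →
      |grad ψ θ i j - grad ψ θ₀ i j| ≤ ε := by
    intro i j ε hε
    obtain ⟨δ, hδ, h⟩ := Metric.tendsto_nhdsWithin_nhds.1 (tendsto_matrix_iff.1 hgc i j) ε hε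
    refine ⟨δ, hδ, ?_⟩
    filter_upwards [ae_hasPartials hN hψm hψ, ae_restrict_mem hN.measurableSet] with θ h1 h2 h3
    exact (h ⟨h2, h1⟩ h3).le
  have hIlim : ∀ i j, ∀ ε > 0, ∃ δ > 0, ∀ᵐ θ ∂(volume.restrict N), dist θ θ₀ < δ →
      |fisherInfo μ (dξ θ) i j - fisherInfo μ (dξ θ₀) i j| ≤ ε := by
    intro i j ε hε
    obtain ⟨δ, hδ, h⟩ := Metric.tendsto_nhds_nhds.1 (tendsto_matrix_iff.1 hIc i j) ε hε
    exact ⟨δ, hδ, Eventually.of_forall fun θ h3 => (h h3).le⟩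
  have hIm : ∀ i j, AEMeasurable (fun θ => fisherInfo μ (dξ θ) i j) (volume.restrict N) := by
    intro i j
    obtain ⟨F, hF, hFe⟩ := M.exists_measurable_fisherInfo hΘ hN.measurableSet hNΘ hdξ i j
    refine ⟨F, hF, ?_⟩
    filter_upwards [ae_restrict_mem hN.measurableSet] with θ hθ using (hFe θ hθ).symm
  have hI := fun (c : ℝ) (hc : 0 < c) i j =>
    hq.tendsto_integral_affine hN hθ₀ (hIm i j) (hIlim i j) hc
  have hG : ∀ c : ℝ, 0 < c →
      Tendsto (fun n : ℕ => avgGrad ψ q θ₀ c n) atTop (𝓝 (grad ψ θ₀)) := fun c hc =>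
    tendsto_matrix_iff.2 fun i j => (hq.tendsto_integral_affine hN hθ₀
      (aemeasurable_grad hN hψm hψ i j) (hGlim i j) hc).2
  set I : E p → Matrix (Fin p) (Fin p) ℝ := fun θ => fisherInfo μ (dξ θ) with hIdef
  set K : ℝ → Matrix (Fin p) (Fin p) ℝ := fun c => (1 / c ^ 2) • priorInfo q + I θ₀ with hK
  have hJ : ∀ c : ℝ, 0 < c → Tendsto (fun n : ℕ => avgInfo I q θ₀ c n) atTop (𝓝 (K c)) :=
    fun c hc => tendsto_const_nhds.add (tendsto_matrix_iff.2 fun i j => (hI c hc i j).2)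
  have hKlim : Tendsto K atTop (𝓝 (I θ₀)) := by
    have h1 : Tendsto (fun c : ℝ => 1 / c ^ 2) atTop (𝓝 0) :=
      tendsto_const_nhds.div_atTop (tendsto_pow_atTop two_ne_zero)
    have h2 := (h1.smul_const (priorInfo q)).add_const (I θ₀)
    rwa [zero_smul, zero_add] at h2
  have hinv : ∀ A : Matrix (Fin p) (Fin p) ℝ, A.det ≠ 0 → ContinuousAt Inv.inv A := by
    intro A hA
    refine continuousAt_matrix_inv A ?_
    rw [Ring.inverse_eq_inv']
    exact continuousAt_inv₀ hA
  have hdet0 : (I θ₀).det ≠ 0 := hdet.ne_zero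
  refine ⟨hdet, ?_, fun c => (grad ψ θ₀)ᵀ * (K c)⁻¹ * grad ψ θ₀, ?_, ?_⟩
  · filter_upwards [eventually_gt_atTop 0] with c hc
    filter_upwards [eventually_all.2 fun i => (hI c hc i i).1] with n hn
    exact integrable_finsetSum _ fun i _ => hn i
  -- Invertibility of `K c` for large `c` comes from that of its limit `I θ₀`.
  · have hKdet : ∀ᶠ c in atTop, (K c).det ≠ 0 :=
      ((Continuous.matrix_det continuous_id).continuousAt.tendsto.comp hKlim).eventually_ne hdet0
    filter_upwards [eventually_gt_atTop 0, hKdet] with c hc hcd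
    have h1 : Tendsto (fun n : ℕ => (avgInfo I q θ₀ c n)⁻¹) atTop (𝓝 (K c)⁻¹) :=
      (hinv _ hcd).tendsto.comp (hJ c hc)
    have h2 : Tendsto (fun n : ℕ => (avgGrad ψ q θ₀ c n)ᵀ) atTop (𝓝 (grad ψ θ₀)ᵀ) :=
      (continuous_id.matrix_transpose.tendsto _).comp (hG c hc)
    exact tendsto_matrix_mul (tendsto_matrix_mul h2 h1) (hG c hc)
  · have h1 : Tendsto (fun c => (K c)⁻¹) atTop (𝓝 (I θ₀)⁻¹) := (hinv _ hdet0).tendsto.comp hKlim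
    exact tendsto_matrix_mul (tendsto_matrix_mul tendsto_const_nhds h1) tendsto_const_nhds

end Continuity

end LAM

/-! ### The local asymptotic minimax theorem -/

theorem theorem3 {p s : ℕ} (hp : 1 ≤ p)
    {X : Type*} [MeasurableSpace X] (μ : Measure X) [SigmaFinite μ]
    (Θ : Set (LAM.E p)) (hΘ : IsOpen Θ) (M : LAM.DominatedModel Θ μ)
    (θ₀ : LAM.E p) (N : Set (LAM.E p)) (hN : IsOpen N) (hNΘ : N ⊆ Θ) (hθ₀ : θ₀ ∈ N)
    -- differentiability of the model along canonical directions at all points of `N`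
    (dξ : LAM.E p → Fin p → X → ℝ) (hdξ : ∀ θ ∈ N, M.HasL2Partials θ (dξ θ))
    -- the target function: nice and bounded on `N`, with a bounded gradient on `N`
    (ψ : LAM.E p → LAM.E s) (hψm : AEMeasurable ψ (volume.restrict N))
    (hψ : ∀ j : Fin s, LAM.IsNice N fun θ => ψ θ j)
    (hψb : ∃ C : ℝ, ∀ θ ∈ N, ‖ψ θ‖ ≤ C)
    (hdψb : ∃ C : ℝ, ∀ᵐ θ ∂(volume.restrict N), ∀ i j, |LAM.grad ψ θ i j| ≤ C)
    (hψ₀ : LAM.HasPartials ψ θ₀) :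
    -- the lower bound
    ((∃ q : LAM.E p → ℝ, LAM.IsRegularPrior q ∧
        LAM.GamConverges (fun θ => LAM.fisherInfo μ (dξ θ)) ψ q θ₀) →
      ∀ ℓ : QuadraticForm ℝ (LAM.E s), (∀ v, 0 ≤ ℓ v) →
      ∀ S : (n : ℕ) → (Fin n → X) → LAM.E s, (∀ n, Measurable (S n)) →
        ∫⁻ v, ENNReal.ofReal (ℓ v) ∂(multivariateGaussian 0
            (LAM.limitCov (fun θ => LAM.fisherInfo μ (dξ θ)) ψ θ₀))
          ≤ liminf (fun c : ℝ => liminf (fun n : ℕ => M.maxRisk ψ ℓ θ₀ c n (S n)) atTop) atTop) ∧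
    -- the sufficient condition for the convergence that is assumed in the lower bound
    (ContinuousWithinAt (LAM.grad ψ) {θ | θ ∈ N ∧ LAM.HasPartials ψ θ} θ₀ →
      ContinuousAt (fun θ => LAM.fisherInfo μ (dξ θ)) θ₀ →
      IsUnit (LAM.fisherInfo μ (dξ θ₀)).det →
        (∃ q : LAM.E p → ℝ, LAM.IsRegularPrior q) ∧
        ∀ q : LAM.E p → ℝ, LAM.IsRegularPrior q →
          LAM.GamConverges (fun θ => LAM.fisherInfo μ (dξ θ)) ψ q θ₀) := by
  refine ⟨fun ⟨q, hq, hΓ⟩ ℓ hℓ S hS => ?_, fun hgc hIc hdet => ⟨LAM.exists_isRegularPrior p,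
    fun q hq => hq.gamConverges hΘ hN hNΘ hθ₀ hdξ hψm hψ hgc hIc hdet⟩⟩
  exact hΓ.lintegral_le_liminf_maxRisk hq hΘ hN hNΘ hθ₀ hdξ hψm hψ hψb hdψb hℓ hS
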